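/- **Setting.** Let $d\ge 1$ and let $\mathcal A$ be the set of complex Hermitian positive semidefinite $d\times d$ matrices of trace $1$; write $\langle X,Y\rangle=\mathrm{Tr}(XY)$. In each round $t=1,\dots,T$ the learner plays $X_t\in\mathcal A$, observes a nonzero positive semidefinite matrix $R_t$, and suffers $f_t(X_t)=-\log\langle X_t,R_t\rangle$. **Algorithm (Schrödinger's-BISONS, parameters $B,\eta,\beta$).** Let $R(X)=-\log\det X$ (equal to $+\infty$ at singular $X$) and, for the played point $X_t$, let $$\hat f_t(X)=f_t(X_t)+\langle X-X_t,\nabla f_t(X_t)\rangle+\tfrac{\beta}{2}\langle X-X_t,\nabla f_t(X_t)\rangle^2,\qquad \nabla f_t(X_t)=-\frac{R_t}{\langle X_t,R_t\rangle}.$$ The rounds are divided into epochs. At the start of every epoch all previous losses are forgotten. Inside an epoch with internal time $\tau=1,2,\dots$, let $P_0=dI$ and $$X_\tau=\arg\min_{X\in\mathcal A}\ \eta^{-1}R(X)+\sum_{s<\tau}\bigl(\hat f_s(X)-B\langle X,P_s-P_{s-1}\rangle\bigr),\qquad U_\tau=\arg\min_{X\in\mathcal A}\ \eta^{-1}R(X)+\sum_{s<\tau}\hat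 f_s(X),$$ $$P_\tau=P_{\tau-1}+X_\tau^{-1/2}\bigl(I-X_\tau^{1/2}P_{\tau-1}X_\tau^{1/2}\bigr)_+X_\tau^{-1/2},$$ where $(\cdot)_+$ replaces the negative eigenvalues by $0$. The algorithm plays $X_\tau$ at internal time $\tau$. After the loss of internal time $\tau$ has been observed, the epoch ends by reset if $U_{\tau+1}\prec \frac{1}{2(1+6\eta)\beta}P_{\tau+1}^{-1}$ fails, and a new epoch starts in the next round; otherwise the epoch continues with $\tau+1$. The regret over an epoch against $U\in\mathcal A$ is $\sum_t (f_t(X_t)-f_t(U))$, summed over the rounds $t\le T$ of that epoch. **Theorem.** There is an absolute constant $C>0$ such that the following holds for all $d\ge1$, all integers $T\ge 110d^2$ and all loss matrices $R_1,\dots,R_T$ as above, when the algorithm is run with $$B=\tfrac{264}{5}\,d^2\log T,\qquad \eta=\frac1{4B},\qquad \beta=\frac{11d}{7B}.$$ 1. For every epoch that ends by reset within the $T$ rounds and every $U\in\mathcal A$ with $U\succeq T^{-1}I$, the regret over the epoch against $U$ is at most $0$. 2. For the last epoch, which runs until the end of time $T$ without a completed reset (it is empty if a reset happens in round $T$), the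 regret over the epoch against every $U\in\mathcal A$ of finite loss, i.e. with $\langle U,R_t\rangle>0$ in all its rounds (in particular against every $U\succeq T^{-1}I$), is at most $C\,d^3\log^2 T$. This covers online learning of quantum states with log loss: if $0\preceq E\preceq I$ is a two-outcome measurement with result $b\in[0,1]$, then $bE+(1-b)(I-E)$ is positive semidefinite, and for every $X\in\mathcal A$ $$-\log\langle X,\,bE+(1-b)(I-E)\rangle=-\log\bigl(b\,p+(1-b)(1-p)\bigr),\qquad p=\langle X,E\rangle .$$ -/

import Mathlib

open scoped ComplexOrder

namespace SchrodingerBISONS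

/-- Complex `d × d` matrices. -/
abbrev Mat (d : ℕ) := Matrix (Fin d) (Fin d) ℂ

/-- The standard inner product `⟨X, Y⟩ = Tr(XY)`; for Hermitian `X`, `Y` the trace is real. -/
noncomputable def ip {d : ℕ} (X Y : Mat d) : ℝ := (X * Y).trace.re

/-- The action set `𝓐`: positive semidefinite Hermitian matrices of trace one. -/
def densityMatrices (d : ℕ) : Set (Mat d) := {X | X.PosSemidef ∧ X.trace = 1}

/-- The part of the action set on which the log-det barrier is finite. -/
def pdDensityMatrices (d : ℕ) : Set (Mat d) := {X | X.PosDef ∧ X.trace = 1}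

/-- The log loss `f(X; R) = -log ⟨X, R⟩`. -/
noncomputable def logLoss {d : ℕ} (X R : Mat d) : ℝ := -Real.log (ip X R)

/-- The gradient `-R / ⟨X, R⟩` of `f(·; R)` at `X`. -/
noncomputable def gradLogLoss {d : ℕ} (X R : Mat d) : Mat d := (-(ip X R)⁻¹) • R

lemma ip_add_smul_left {d : ℕ} (X H R : Mat d) (h : ℝ) :
    ip (X + h • H) R = ip X R + h * ip H R := by
  simp [ip, add_mul, Matrix.trace_add, Matrix.trace_smul]

lemma ip_smul_right {d : ℕ} (X R : Mat d) (c : ℝ) : ip X (c • R) = c * ip X R := by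
  simp [ip, Matrix.trace_smul]

/-- `gradLogLoss X R` represents all directional derivatives of the log loss at `X`. -/
theorem hasDerivAt_logLoss {d : ℕ} (X R Y : Mat d) (hX : 0 < ip X R) :
    HasDerivAt (fun h : ℝ => logLoss (X + h • (Y - X)) R)
      (ip (Y - X) (gradLogLoss X R)) 0 := by
  have h1 : HasDerivAt (fun h : ℝ => ip X R + h * ip (Y - X) R) (ip (Y - X) R) 0 := by
    simpa using ((hasDerivAt_id (0 : ℝ)).mul_const (ip (Y - X) R)).const_add (ip X R)
  have h2 := (h1.log (by simpa using hX.ne')).neg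
  have h3 : ip (Y - X) (gradLogLoss X R) = -(ip (Y - X) R / (ip X R + 0 * ip (Y - X) R)) := by
    rw [gradLogLoss, ip_smul_right]
    simp [div_eq_inv_mul]
  rw [h3]
  simp only [logLoss, ip_add_smul_left]
  exact h2

/-- The quadratic surrogate of the log loss `f(·; R)` around the played point `X₀`:
`Y ↦ f(X₀) + ⟨Y - X₀, ∇f(X₀)⟩ + (β / 2) ⟨Y - X₀, ∇f(X₀)⟩²`. -/
noncomputable def surrogate {d : ℕ} (β : ℝ) (X₀ R : Mat d) (Y : Mat d) : ℝ :=
  logLoss X₀ R + ip (Y - X₀) (gradLogLoss X₀ R) + β / 2 * ip (Y - X₀) (gradLogLoss X₀ R) ^ 2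

/-- The log-det barrier `R(X) = -log det X` on positive definite matrices
(whose determinant is a positive real number). -/
noncomputable def logDetBarrier {d : ℕ} (X : Mat d) : ℝ := -Real.log X.det.re

/-- A minimizer of `F` over the action set, for an `F` that contains a positive multiple of the
log-det barrier. Such an `F` is `+∞` at singular matrices, so it is minimized over the positive
definite density matrices. -/
noncomputable def argminDensity {d : ℕ} (F : Mat d → ℝ) : Mat d :=
  Classical.epsilon fun X => X ∈ pdDensityMatrices d ∧ ∀ Y ∈ pdDensityMatrices d, F X ≤ F Y

/-- The square root of a positive semidefinite matrix. -/
noncomputable def msqrt {d : ℕ} (X : Mat d) : Mat d := cfc Real.sqrt X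

/-- The positive part of a Hermitian matrix: all negative eigenvalues are replaced by zero. -/
noncomputable def mpos {d : ℕ} (M : Mat d) : Mat d := cfc (fun x : ℝ => max x 0) M

/-- The bias update
`P ↦ P + X^(-1/2) (I - X^(1/2) P X^(1/2))₊ X^(-1/2)`. -/
noncomputable def biasUpdate {d : ℕ} (P X : Mat d) : Mat d :=
  P + (msqrt X)⁻¹ * mpos (1 - msqrt X * P * msqrt X) * (msqrt X)⁻¹

/-- The memory of the algorithm at internal time `τ` of an epoch, before the loss matrix of the
round is revealed. -/
structure State (d : ℕ) where
  /-- the number `e` of the current epoch -/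
  epoch : ℕ
  /-- the regularized sum of surrogate losses up to internal time `τ - 1` -/
  Fhat : Mat d → ℝ
  /-- the regularized sum of biased surrogate losses up to internal time `τ - 1` -/
  G : Mat d → ℝ
  /-- the point `X_τ` to be played -/
  X : Mat d
  /-- the reference solution `U_τ` -/
  U : Mat d
  /-- the bias matrix `P_(τ-1)` -/
  Pprev : Mat d
  /-- the bias matrix `P_τ` -/
  P : Mat d

/-- The state at the start (`τ = 1`) of epoch number `e`: `P₀ = d I`, both objectives are the
regularizer `η⁻¹ R`, and `X₁ = U₁` is its minimizer. -/
noncomputable def State.start (d : ℕ) (η : ℝ) (e : ℕ) : State d where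
  epoch := e
  Fhat := fun Y => η⁻¹ * logDetBarrier Y
  G := fun Y => η⁻¹ * logDetBarrier Y
  X := argminDensity fun Y => η⁻¹ * logDetBarrier Y
  U := argminDensity fun Y => η⁻¹ * logDetBarrier Y
  Pprev := (d : ℝ) • (1 : Mat d)
  P := biasUpdate ((d : ℝ) • (1 : Mat d)) (argminDensity fun Y => η⁻¹ * logDetBarrier Y)

/-- The state at internal time `τ + 1` of the same epoch, after loss matrix `R` was revealed. -/
noncomputable def State.advance {d : ℕ} (B β : ℝ) (s : State d) (R : Mat d) : State d :=
  let fhat : Mat d → ℝ := surrogate β s.X R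
  let F' : Mat d → ℝ := fun Y => s.Fhat Y + fhat Y
  let G' : Mat d → ℝ := fun Y => s.G Y + (fhat Y - ip Y (s.P - s.Pprev) * B)
  let X' : Mat d := argminDensity G'
  { epoch := s.epoch
    Fhat := F'
    G := G'
    X := X'
    U := argminDensity F'
    Pprev := s.P
    P := biasUpdate s.P X' }

/-- The reset condition, evaluated on the newly computed `U_(τ+1)` and `P_(τ+1)`:
`U ≺ (2 (1 + 6 η) β)⁻¹ P⁻¹` fails. -/
def State.ResetCondition {d : ℕ} (η β : ℝ) (s : State d) : Prop :=
  ¬ ((2 * (1 + 6 * η) * β)⁻¹ • s.P⁻¹ - s.U).PosDef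

open Classical in
/-- One round of Schrödinger's-BISONS with revealed loss matrix `R`. -/
noncomputable def State.step {d : ℕ} (B η β : ℝ) (s : State d) (R : Mat d) : State d :=
  if (s.advance B β R).ResetCondition η β then State.start d η (s.epoch + 1)
  else s.advance B β R

/-- The state of Schrödinger's-BISONS after `t` rounds against the loss matrices
`R 0, R 1, …`; rounds are numbered from `0`, so round `t` plays `(run B η β R t).X`. -/
noncomputable def run {d : ℕ} (B η β : ℝ) (R : ℕ → Mat d) : ℕ → State d
  | 0 => State.start d η 1
  | t + 1 => (run B η β R t).step B η β (R t)

/-- The rounds among the first `T` that belong to epoch number `e`. -/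
noncomputable def epochRounds {d : ℕ} (B η β : ℝ) (R : ℕ → Mat d) (T e : ℕ) : Finset ℕ :=
  (Finset.range T).filter fun t => (run B η β R t).epoch = e

/-- The regret of Schrödinger's-BISONS over epoch number `e` of a game with `T` rounds, against
the comparator `U`. -/
noncomputable def epochRegret {d : ℕ} (B η β : ℝ) (R : ℕ → Mat d) (T e : ℕ) (U : Mat d) : ℝ :=
  ∑ t ∈ epochRounds B η β R T e, (logLoss (run B η β R t).X (R t) - logLoss U (R t))

/-- The loss matrix `b E + (1 - b) (I - E)` that encodes the two-outcome measurement `E` with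
result `b`. -/
noncomputable def measurementLossMatrix {d : ℕ} (E : Mat d) (b : ℝ) : Mat d :=
  b • E + (1 - b) • (1 - E)

/-- The log loss `-log (b p + (1 - b) (1 - p))` of the prediction `p` when the result is `b`. -/
noncomputable def binaryLogLoss (p b : ℝ) : ℝ := -Real.log (b * p + (1 - b) * (1 - p))

end SchrodingerBISONS

open SchrodingerBISONS

/-!
# Regret of Schrödinger's-BISONS, epoch by epoch

Write `F̂ = η⁻¹ R + ∑ f̂ₛ` for the regularized surrogate losses of an epoch, `U` for the minimizer of
`F̂`, `X` for the played points, `P` for the bias matrices and `L = log T`.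

*Everything moves slowly.* A positive definite `X` and a Hermitian `H` can be diagonalized by a
common congruence (`exists_congDiag`), so that `log det` near `X` becomes a sum of one-dimensional
logarithms. Its Bregman divergence then dominates the square of the local norm
`‖X^(-1/2) H X^(-1/2)‖_F` (`logDetBarrier_bregman`). A loss `f̂ₛ` has dual local norm at most one at
`Xₛ`, and the bias increment at `X_(s+1)` is at most the preceding step from `Xₛ` to `X_(s+1)`
(`localNorm_biasUpdate_sub_le`); since `η B = 1 / 4`, induction bounds all steps by `6 η`
(`epoch_stability`).

*Surrogate regret.* In the regret decomposition of follow-the-regularized-leader the quadratic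
parts of the surrogates pay for the gradients through the elliptic potential lemma in the
`d²`-dimensional space of Hermitian matrices (`sum_linear_sub_quadratic_le`), and the growth of
`log det P` pays for the bias at the played points (`ip_biasUpdate_sub_le`). What is gained is
`-B ⟨U, P⟩` (`surrogate_regret_le`).

*Log losses.* If `⟨U, Rₛ⟩ ≤ (3 / (4 β)) ⟨Xₛ, Rₛ⟩` in all rounds, then the tangent of every
surrogate at `U` lies below the log loss on the whole action set (`tangent_le_neg_log`). By
convexity and first-order optimality of `U`, the regularized log loss of *every* comparator is at
least `F̂ U` (`ftrlObjective_le_logLoss`), although the surrogates themselves are not lower bounds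
far away from `U`. The condition holds while no reset is triggered, because `P` dominates all
`Xₛ⁻¹`, and still holds at the moment of a reset, because `U` moves slowly (`inTightRegion_succ`).
The same optimality condition gives `tr P ≤ (T / (16 d)) ⟨U, P⟩`.

Together, with `a = ⟨U, P⟩ / d`, the regret of an epoch is at most
`4 B (R(Y) - d log d) + d B (43/22 L + 18/11 log a + 1 - a)` (`epoch_regret_le`). This is
`O(d B L) = O(d³ L²)` in general. At a reset `a ≥ 16 L` (`le_ip_of_reset`), so the linear term wins
over everything else, and the regret is nonpositive.
-/

namespace SchrodingerBISONS

open Matrix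

variable {d : ℕ}

/-! ### The trace inner product -/

lemma ip_comm (X Y : Mat d) : ip X Y = ip Y X := by
  rw [ip, ip, Matrix.trace_mul_comm]

lemma ip_add_left (X Y Z : Mat d) : ip (X + Y) Z = ip X Z + ip Y Z := by
  simp [ip, add_mul, Matrix.trace_add]

lemma ip_sub_left (X Y Z : Mat d) : ip (X - Y) Z = ip X Z - ip Y Z := by
  simp [ip, sub_mul, Matrix.trace_sub]

lemma ip_smul_left (c : ℝ) (X Y : Mat d) : ip (c • X) Y = c * ip X Y := by
  rw [ip_comm, ip_smul_right, ip_comm]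

lemma ip_add_right (X Y Z : Mat d) : ip X (Y + Z) = ip X Y + ip X Z := by
  rw [ip_comm, ip_add_left, ip_comm Y, ip_comm Z]

lemma ip_sub_right (X Y Z : Mat d) : ip X (Y - Z) = ip X Y - ip X Z := by
  rw [ip_comm, ip_sub_left, ip_comm Y, ip_comm Z]

lemma ip_zero_right (X : Mat d) : ip X 0 = 0 := by simp [ip]

lemma ip_one_right (X : Mat d) : ip X 1 = X.trace.re := by simp [ip]

/-! ### Congruence to diagonal form -/

/-- The Hermitian matrix `W diag(μ) Wᴴ`, i.e. the real diagonal matrix `diag(μ)` seen through the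
congruence by `W`. -/
noncomputable def congDiag (W : Mat d) (μ : Fin d → ℝ) : Mat d :=
  W * diagonal (fun i => (μ i : ℂ)) * Wᴴ

lemma congDiag_one (W : Mat d) : congDiag W 1 = W * Wᴴ := by simp [congDiag]

lemma congDiag_add (W : Mat d) (μ ν : Fin d → ℝ) :
    congDiag W (μ + ν) = congDiag W μ + congDiag W ν := by
  rw [congDiag, congDiag, congDiag, ← add_mul, ← mul_add, Matrix.diagonal_add]
  simp

lemma congDiag_sub (W : Mat d) (μ ν : Fin d → ℝ) :
    congDiag W (μ - ν) = congDiag W μ - congDiag W ν := by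
  rw [congDiag, congDiag, congDiag, ← sub_mul, ← mul_sub, Matrix.diagonal_sub]
  simp

lemma congDiag_smul (W : Mat d) (c : ℝ) (μ : Fin d → ℝ) :
    congDiag W (c • μ) = c • congDiag W μ := by
  rw [congDiag, congDiag, ← Matrix.smul_mul, ← Matrix.mul_smul, ← Matrix.diagonal_smul]
  congr 3
  ext i
  simp

lemma posSemidef_congDiag {W : Mat d} {μ : Fin d → ℝ} (hμ : ∀ i, 0 ≤ μ i) :
    (congDiag W μ).PosSemidef := by
  refine PosSemidef.mul_mul_conjTranspose_same ?_ W
  rw [posSemidef_diagonal_iff]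
  exact fun i => by exact_mod_cast hμ i

lemma posSemidef_congDiag_iff {W : Mat d} (hW : IsUnit W) {μ : Fin d → ℝ} :
    (congDiag W μ).PosSemidef ↔ ∀ i, 0 ≤ μ i := by
  rw [congDiag, ← star_eq_conjTranspose, hW.posSemidef_star_right_conjugate_iff,
    posSemidef_diagonal_iff]
  simp

lemma posDef_congDiag_iff {W : Mat d} (hW : IsUnit W) {μ : Fin d → ℝ} :
    (congDiag W μ).PosDef ↔ ∀ i, 0 < μ i := by
  rw [congDiag, ← star_eq_conjTranspose, IsUnit.posDef_star_right_conjugate_iff hW,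
    posDef_diagonal_iff]
  simp

lemma ip_congDiag (W : Mat d) (μ : Fin d → ℝ) (R : Mat d) :
    ip (congDiag W μ) R = ∑ i, μ i * ((Wᴴ * R * W) i i).re := by
  have h : (congDiag W μ * R).trace = (diagonal (fun i => (μ i : ℂ)) * (Wᴴ * R * W)).trace := by
    rw [congDiag, Matrix.mul_assoc, Matrix.mul_assoc, Matrix.trace_mul_comm]
    simp only [Matrix.mul_assoc]
  rw [ip, h, Matrix.trace, Complex.re_sum]
  refine Finset.sum_congr rfl fun i _ => ?_
  rw [Matrix.diag_apply, Matrix.diagonal_mul, Complex.re_ofReal_mul]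

lemma ip_congDiag_dual {V W : Mat d} (h : Vᴴ * W = 1) (μ ν : Fin d → ℝ) :
    ip (congDiag V μ) (congDiag W ν) = ∑ i, μ i * ν i := by
  have h' : Wᴴ * V = 1 := by
    simpa using congrArg conjTranspose h
  rw [ip_congDiag]
  refine Finset.sum_congr rfl fun i _ => ?_
  have : Vᴴ * congDiag W ν * V = diagonal (fun i => (ν i : ℂ)) := by
    rw [congDiag]
    calc Vᴴ * (W * diagonal (fun i => (ν i : ℂ)) * Wᴴ) * V
        = (Vᴴ * W) * diagonal (fun i => (ν i : ℂ)) * (Wᴴ * V) := by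
          simp only [Matrix.mul_assoc]
      _ = _ := by rw [h, h']; simp
  rw [this]
  simp

/-- The matrix `W⁻ᴴ` dual to the congruence `W`: inverses and gradients of matrices that are
diagonal for `W` are diagonal for `W⁻ᴴ`. -/
noncomputable def dualCong (W : Mat d) : Mat d := (Wᴴ)⁻¹

lemma isUnit_dualCong {W : Mat d} (hW : IsUnit W) : IsUnit (dualCong W) := by
  rw [dualCong, isUnit_nonsing_inv_iff]
  exact hW.star

lemma dualCong_mul {W : Mat d} (hW : IsUnit W) : (dualCong W)ᴴ * W = 1 := by
  rw [dualCong, conjTranspose_nonsing_inv, conjTranspose_conjTranspose]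
  exact nonsing_inv_mul _ ((isUnit_iff_isUnit_det _).1 hW)

lemma mul_dualCong {W : Mat d} (hW : IsUnit W) : Wᴴ * dualCong W = 1 := by
  simpa using congrArg conjTranspose (dualCong_mul hW)

lemma congDiag_mul_dual {W : Mat d} (hW : IsUnit W) (μ ν : Fin d → ℝ) :
    congDiag W μ * congDiag (dualCong W) ν = W * diagonal (fun i => ((μ i * ν i : ℝ) : ℂ)) *
      (dualCong W)ᴴ := by
  rw [congDiag, congDiag]
  calc W * diagonal (fun i => (μ i : ℂ)) * Wᴴ *
        (dualCong W * diagonal (fun i => (ν i : ℂ)) * (dualCong W)ᴴ)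
      = W * (diagonal (fun i => (μ i : ℂ)) * (Wᴴ * dualCong W) * diagonal (fun i => (ν i : ℂ))) *
        (dualCong W)ᴴ := by simp only [Matrix.mul_assoc]
    _ = _ := by rw [mul_dualCong hW]; simp

lemma inv_congDiag {W : Mat d} (hW : IsUnit W) {μ : Fin d → ℝ} (hμ : ∀ i, μ i ≠ 0) :
    (congDiag W μ)⁻¹ = congDiag (dualCong W) μ⁻¹ := by
  refine inv_eq_right_inv ?_
  rw [congDiag_mul_dual hW]
  have : (fun i => ((μ i * μ⁻¹ i : ℝ) : ℂ)) = 1 := by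
    ext i
    simp [hμ i]
  rw [this, show diagonal (1 : Fin d → ℂ) = 1 from diagonal_one, Matrix.mul_one]
  exact mul_eq_one_comm.1 (dualCong_mul hW)

lemma inv_congDiag_one {W : Mat d} (hW : IsUnit W) :
    (congDiag W 1)⁻¹ = congDiag (dualCong W) 1 := by
  rw [inv_congDiag hW (by simp), inv_one]

lemma congDiag_dual_sandwich {W : Mat d} (hW : IsUnit W) (μ : Fin d → ℝ) :
    congDiag (dualCong W) 1 * congDiag W μ * congDiag (dualCong W) 1
      = congDiag (dualCong W) μ := by
  rw [Matrix.mul_assoc, congDiag_mul_dual hW, congDiag_one, congDiag]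
  calc dualCong W * (dualCong W)ᴴ * (W * diagonal (fun i => ((μ i * 1 : ℝ) : ℂ)) * (dualCong W)ᴴ)
      = dualCong W * (((dualCong W)ᴴ * W) * diagonal (fun i => ((μ i * 1 : ℝ) : ℂ)))
          * (dualCong W)ᴴ := by simp only [Matrix.mul_assoc]
    _ = _ := by rw [dualCong_mul hW]; simp

lemma det_congDiag (W : Mat d) (μ : Fin d → ℝ) :
    (congDiag W μ).det.re = Complex.normSq W.det * ∏ i, μ i := by
  have h : (congDiag W μ).det = ((Complex.normSq W.det * ∏ i, μ i : ℝ) : ℂ) := by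
    rw [congDiag, det_mul, det_mul, det_diagonal, det_conjTranspose]
    push_cast
    rw [Complex.normSq_eq_conj_mul_self, Complex.star_def]
    ring
  rw [h, Complex.ofReal_re]

lemma logDetBarrier_congDiag {W : Mat d} (hW : IsUnit W) {μ : Fin d → ℝ} (hμ : ∀ i, 0 < μ i) :
    logDetBarrier (congDiag W μ) = logDetBarrier (congDiag W 1) - ∑ i, Real.log (μ i) := by
  have h0 : Complex.normSq W.det ≠ 0 := by
    rw [Ne, Complex.normSq_eq_zero]
    exact ((isUnit_iff_isUnit_det _).1 hW).ne_zero
  rw [logDetBarrier, logDetBarrier, det_congDiag, det_congDiag,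
    Real.log_mul h0 (Finset.prod_pos fun i _ => hμ i).ne',
    Real.log_prod fun i _ => (hμ i).ne']
  simp
  ring

lemma msqrt_mul_self {X : Mat d} (hX : X.PosSemidef) : msqrt X * msqrt X = X := by
  have hs : IsSelfAdjoint X := hX.1
  rw [msqrt, ← cfc_mul Real.sqrt Real.sqrt X]
  conv_rhs => rw [← cfc_id ℝ X]
  refine cfc_congr fun x hx => ?_
  obtain ⟨i, rfl⟩ := (Matrix.IsHermitian.spectrum_real_eq_range_eigenvalues hX.1) ▸ hx
  exact Real.mul_self_sqrt (hX.eigenvalues_nonneg i)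

lemma msqrt_isHermitian (X : Mat d) : (msqrt X).IsHermitian :=
  cfc_predicate Real.sqrt X

lemma isUnit_msqrt {X : Mat d} (hX : X.PosDef) : IsUnit (msqrt X) :=
  isUnit_of_mul_isUnit_left (y := msqrt X) (by rw [msqrt_mul_self hX.posSemidef]; exact hX.isUnit)

/-- The spectral theorem together with its description of the functional calculus. -/
lemma exists_unitary_cfc {M : Mat d} (hM : M.IsHermitian) :
    ∃ (V : Mat d) (m : Fin d → ℝ), V * Vᴴ = 1 ∧ Vᴴ * V = 1 ∧ M = congDiag V m ∧
      ∀ f : ℝ → ℝ, cfc f M = congDiag V (f ∘ m) := by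
  refine ⟨hM.eigenvectorUnitary, hM.eigenvalues, ?_, ?_, ?_, fun f => ?_⟩
  · exact Unitary.mul_star_self_of_mem hM.eigenvectorUnitary.2
  · exact Unitary.star_mul_self_of_mem hM.eigenvectorUnitary.2
  · conv_lhs => rw [hM.spectral_theorem]
    rfl
  · rw [hM.cfc_eq]
    rfl

/-- Simultaneous diagonalization by congruence: a positive definite `X` becomes the identity and
a Hermitian `H` becomes diagonal. -/
lemma exists_congDiag {X H : Mat d} (hX : X.PosDef) (hH : H.IsHermitian) :
    ∃ (W : Mat d) (l : Fin d → ℝ), IsUnit W ∧ X = congDiag W 1 ∧ H = congDiag W l := by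
  set S := msqrt X with hS
  have hSu : IsUnit S := isUnit_msqrt hX
  have hSd : IsUnit S.det := (isUnit_iff_isUnit_det _).1 hSu
  have hSh : Sᴴ = S := msqrt_isHermitian X
  have hE : (S⁻¹ * H * S⁻¹).IsHermitian := by
    rw [IsHermitian, conjTranspose_mul, conjTranspose_mul, conjTranspose_nonsing_inv, hSh, hH.eq,
      Matrix.mul_assoc]
  obtain ⟨V, l, hV1, hV2, hl, -⟩ := exists_unitary_cfc hE
  refine ⟨S * V, l, hSu.mul (IsUnit.of_mul_eq_one _ hV1), ?_, ?_⟩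
  · rw [congDiag_one, conjTranspose_mul, hSh, Matrix.mul_assoc, ← Matrix.mul_assoc V, hV1,
      Matrix.one_mul, hS, msqrt_mul_self hX.posSemidef]
  · have : congDiag (S * V) l = S * congDiag V l * S := by
      simp only [congDiag, conjTranspose_mul, hSh, Matrix.mul_assoc]
    rw [this, ← hl]
    calc H = (S * S⁻¹) * H * (S⁻¹ * S) := by
          rw [mul_nonsing_inv _ hSd, nonsing_inv_mul _ hSd]; simp
      _ = _ := by simp only [Matrix.mul_assoc]

/-! ### Positivity of the inner product -/

lemma diag_conj_re_nonneg {R : Mat d} (hR : R.PosSemidef) (W : Mat d) (i : Fin d) :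
    0 ≤ ((Wᴴ * R * W) i i).re :=
  (Complex.le_def.1 (hR.conjTranspose_mul_mul_same W).diag_nonneg).1

lemma ip_nonneg {X R : Mat d} (hX : X.PosSemidef) (hR : R.PosSemidef) : 0 ≤ ip X R := by
  obtain ⟨W, l, hW, -, hl⟩ := exists_congDiag PosDef.one hX.1
  subst hl
  rw [ip_congDiag]
  exact Finset.sum_nonneg fun i _ =>
    mul_nonneg ((posSemidef_congDiag_iff hW).1 hX i) (diag_conj_re_nonneg hR W i)

lemma ip_mono_left {X Y R : Mat d} (h : (Y - X).PosSemidef) (hR : R.PosSemidef) :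
    ip X R ≤ ip Y R := by
  have := ip_nonneg h hR
  rw [ip_sub_left] at this
  linarith

lemma ip_pos {X R : Mat d} (hX : X.PosDef) (hR : R.PosSemidef) (h0 : R ≠ 0) : 0 < ip X R := by
  obtain ⟨W, l, hW, hXW, -⟩ := exists_congDiag hX hX.1
  have htr : ip X R = (Wᴴ * R * W).trace.re := by
    rw [hXW, ip_congDiag, Matrix.trace, Complex.re_sum]
    simp
  have hP := hR.conjTranspose_mul_mul_same W
  refine lt_of_le_of_ne (ip_nonneg hX.posSemidef hR) fun h => h0 ?_
  have h1 : (Wᴴ * R * W).trace = 0 :=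
    Complex.ext (by rw [← htr, ← h]; rfl) (Complex.le_def.1 hP.trace_nonneg).2.symm
  rw [hP.trace_eq_zero_iff] at h1
  have hWu : IsUnit W.det := (isUnit_iff_isUnit_det _).1 hW
  have hWu' : IsUnit Wᴴ.det := (isUnit_iff_isUnit_det _).1 hW.star
  calc R = (Wᴴ)⁻¹ * Wᴴ * R * (W * W⁻¹) := by
        rw [nonsing_inv_mul _ hWu', mul_nonsing_inv _ hWu]; simp
    _ = (Wᴴ)⁻¹ * (Wᴴ * R * W) * W⁻¹ := by simp only [Matrix.mul_assoc]
    _ = 0 := by rw [h1]; simp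

lemma trace_re_nonneg {X : Mat d} (hX : X.PosSemidef) : 0 ≤ X.trace.re :=
  (Complex.le_def.1 hX.trace_nonneg).1

lemma posSemidef_smul {X : Mat d} (hX : X.PosSemidef) {c : ℝ} (hc : 0 ≤ c) :
    (c • X).PosSemidef := hX.smul hc

lemma posDef_smul {X : Mat d} (hX : X.PosDef) {c : ℝ} (hc : 0 < c) :
    (c • X).PosDef := hX.smul hc

lemma inv_inv_of_posDef {X : Mat d} (hX : X.PosDef) : (X⁻¹)⁻¹ = X :=
  nonsing_inv_nonsing_inv _ ((isUnit_iff_isUnit_det _).1 hX.isUnit)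

/-- Inversion is antitone on positive definite matrices. -/
lemma inv_sub_inv_posSemidef {A B : Mat d} (hA : A.PosDef) (h : (B - A).PosSemidef) :
    (A⁻¹ - B⁻¹).PosSemidef := by
  obtain ⟨W, l, hW, hAW, hl⟩ := exists_congDiag hA h.1
  have hl0 : ∀ i, 0 ≤ l i := by
    rw [hl] at h
    exact (posSemidef_congDiag_iff hW).1 h
  have hB : B = congDiag W (1 + l) := by
    rw [congDiag_add, ← hAW, ← hl]; abel
  have h1 : ∀ i, 0 < (1 + l) i := fun i => by
    have := hl0 i
    simp only [Pi.add_apply, Pi.one_apply]; linarith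
  rw [hB, hAW, inv_congDiag_one hW, inv_congDiag hW fun i => (h1 i).ne', ← congDiag_sub]
  refine posSemidef_congDiag fun i => ?_
  simp only [Pi.sub_apply, Pi.one_apply, Pi.inv_apply]
  exact sub_nonneg.2 (inv_le_one_of_one_le₀ (by
    have := hl0 i
    simp only [Pi.add_apply, Pi.one_apply]; linarith))

/-! ### The local norm of the log-det barrier -/

/-- The norm `‖X^(-1/2) H X^(-1/2)‖_F`, which the Hessian of the log-det barrier at `X` induces on
Hermitian matrices `H`. For positive definite `X` and Hermitian `H` the radicand is a sum of
squares (`localNorm_sq`). -/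
noncomputable def localNorm (X H : Mat d) : ℝ := √(ip (X⁻¹ * H * X⁻¹) H)

lemma localNorm_nonneg (X H : Mat d) : 0 ≤ localNorm X H := Real.sqrt_nonneg _

lemma ip_inv_congDiag {W : Mat d} (hW : IsUnit W) (l : Fin d → ℝ) :
    ip (congDiag W 1)⁻¹ (congDiag W l) = ∑ i, l i := by
  rw [inv_congDiag_one hW, ip_congDiag_dual (dualCong_mul hW)]
  simp

lemma ip_sandwich_congDiag {W : Mat d} (hW : IsUnit W) (l : Fin d → ℝ) :
    ip ((congDiag W 1)⁻¹ * congDiag W l * (congDiag W 1)⁻¹) (congDiag W l) = ∑ i, l i ^ 2 := by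
  rw [inv_congDiag_one hW, congDiag_dual_sandwich hW, ip_congDiag_dual (dualCong_mul hW)]
  exact Finset.sum_congr rfl fun i _ => (sq _).symm

lemma localNorm_congDiag_sq {W : Mat d} (hW : IsUnit W) (l : Fin d → ℝ) :
    localNorm (congDiag W 1) (congDiag W l) ^ 2 = ∑ i, l i ^ 2 := by
  rw [localNorm, ip_sandwich_congDiag hW, Real.sq_sqrt (Finset.sum_nonneg fun i _ => sq_nonneg _)]

lemma abs_le_of_sum_sq {l : Fin d → ℝ} {e : ℝ} (he : 0 ≤ e) (h : e ^ 2 = ∑ i, l i ^ 2)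
    (i : Fin d) : |l i| ≤ e := by
  refine abs_le_of_sq_le_sq ?_ he
  rw [h]
  exact Finset.single_le_sum (f := fun i => l i ^ 2) (fun i _ => sq_nonneg _) (Finset.mem_univ i)

lemma localNorm_sq {X H : Mat d} (hX : X.PosDef) (hH : H.IsHermitian) :
    localNorm X H ^ 2 = ip (X⁻¹ * H * X⁻¹) H := by
  obtain ⟨W, l, hW, rfl, rfl⟩ := exists_congDiag hX hH
  rw [localNorm_congDiag_sq hW, ip_sandwich_congDiag hW]

/-- In the local norm at `X`, a positive semidefinite `R` has dual norm at most `⟨X, R⟩`. -/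
lemma abs_ip_le_localNorm_mul {X H R : Mat d} (hX : X.PosDef) (hH : H.IsHermitian)
    (hR : R.PosSemidef) : |ip H R| ≤ localNorm X H * ip X R := by
  obtain ⟨W, l, hW, rfl, rfl⟩ := exists_congDiag hX hH
  have habs := abs_le_of_sum_sq (localNorm_nonneg _ _) (localNorm_congDiag_sq hW l)
  rw [ip_congDiag, ip_congDiag, Finset.mul_sum]
  refine (Finset.abs_sum_le_sum_abs _ _).trans (Finset.sum_le_sum fun i _ => ?_)
  rw [abs_mul, abs_of_nonneg (diag_conj_re_nonneg hR W i), Pi.one_apply, one_mul]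
  exact mul_le_mul_of_nonneg_right (habs i) (diag_conj_re_nonneg hR W i)

lemma half_sq_le_sub_log {t : ℝ} (ht : -1 < t) (h : t ≤ 0) :
    t ^ 2 / 2 ≤ t - Real.log (1 + t) := by
  have hs := Real.hasSum_pow_div_log_of_abs_lt_one (x := -t)
    (by rw [abs_lt]; constructor <;> linarith)
  have h1 := sum_le_hasSum (Finset.range 2) (fun n _ => by
    have : 0 ≤ -t := by linarith
    positivity) hs
  norm_num [Finset.sum_range_succ] at h1
  linarith

/-- The one-dimensional Bregman divergence of `-log` around `1`, on `|t| ≤ e`. -/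
lemma sq_div_le_sub_log {t e : ℝ} (ht : -1 < t) (hte : |t| ≤ e) :
    t ^ 2 / (2 * (1 + e)) ≤ t - Real.log (1 + t) := by
  have he : 0 ≤ e := (abs_nonneg t).trans hte
  rcases le_total 0 t with h | h
  · have h1 : Real.log (1 + t) ≤ ((1 + t) - (1 + t)⁻¹) / 2 := by
      rw [← Real.sinh_log (by linarith)]
      exact Real.self_le_sinh_iff.2 (Real.log_nonneg (by linarith))
    have h2 : t - ((1 + t) - (1 + t)⁻¹) / 2 = t ^ 2 / (2 * (1 + t)) := by
      field_simp
      ring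
    have h3 : t ^ 2 / (2 * (1 + e)) ≤ t ^ 2 / (2 * (1 + t)) := by
      rw [abs_of_nonneg h] at hte
      gcongr
    linarith
  · have h1 := half_sq_le_sub_log ht h
    have h3 : t ^ 2 / (2 * (1 + e)) ≤ t ^ 2 / 2 := by
      gcongr
      linarith
    linarith

/-- The Bregman divergence of the log-det barrier dominates the squared local norm. -/
lemma logDetBarrier_bregman {X Y : Mat d} (hX : X.PosDef) (hY : Y.PosDef) :
    localNorm X (Y - X) ^ 2 / (2 * (1 + localNorm X (Y - X)))
      ≤ logDetBarrier Y - logDetBarrier X + ip X⁻¹ (Y - X) := by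
  obtain ⟨W, l, hW, hXW, hl⟩ := exists_congDiag hX (hY.1.sub hX.1)
  have hYW : Y = congDiag W (1 + l) := by
    rw [congDiag_add, ← hXW, ← hl]; abel
  have hpos : ∀ i, 0 < (1 + l) i := by
    rw [hYW] at hY
    exact (posDef_congDiag_iff hW).1 hY
  rw [hl, hYW, hXW]
  have hsq := localNorm_congDiag_sq hW l
  have habs := abs_le_of_sum_sq (localNorm_nonneg _ _) hsq
  rw [logDetBarrier_congDiag hW hpos, ip_inv_congDiag hW, hsq, Finset.sum_div]
  have := Finset.sum_le_sum fun i (_ : i ∈ Finset.univ) =>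
    sq_div_le_sub_log (t := l i) (by have := hpos i; simp at this; linarith) (habs i)
  rw [Finset.sum_sub_distrib] at this
  simp only [Pi.add_apply, Pi.one_apply]
  linarith

lemma logDetBarrier_gradient_le {X Y : Mat d} (hX : X.PosDef) (hY : Y.PosDef) :
    logDetBarrier X - ip X⁻¹ (Y - X) ≤ logDetBarrier Y := by
  have h := logDetBarrier_bregman hX hY
  have := localNorm_nonneg X (Y - X)
  have : 0 ≤ localNorm X (Y - X) ^ 2 / (2 * (1 + localNorm X (Y - X))) := by positivity
  linarith

lemma hasDerivAt_logDetBarrier {X H : Mat d} (hX : X.PosDef) (hH : H.IsHermitian) :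
    HasDerivAt (fun h : ℝ => logDetBarrier (X + h • H)) (-ip X⁻¹ H) 0 := by
  obtain ⟨W, l, hW, rfl, rfl⟩ := exists_congDiag hX hH
  rw [ip_inv_congDiag hW]
  have hev : ∀ᶠ h : ℝ in nhds 0, ∀ i, 0 < 1 + h * l i := by
    rw [Filter.eventually_all]
    intro i
    have : ContinuousAt (fun h : ℝ => 1 + h * l i) 0 := by fun_prop
    exact this.eventually (lt_mem_nhds (by simp))
  have hd : HasDerivAt (fun h : ℝ => logDetBarrier (congDiag W 1) - ∑ i, Real.log (1 + h * l i))
      (-∑ i, l i) 0 := by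
    have : HasDerivAt (fun h : ℝ => ∑ i, Real.log (1 + h * l i)) (∑ i, l i) 0 := by
      refine HasDerivAt.fun_sum fun i _ => ?_
      have h1 : HasDerivAt (fun h : ℝ => 1 + h * l i) (l i) 0 := by
        simpa using ((hasDerivAt_id (0 : ℝ)).mul_const (l i)).const_add 1
      simpa using h1.log (by simp)
    exact this.const_sub _
  refine hd.congr_of_eventuallyEq ?_
  filter_upwards [hev] with h hh
  rw [← congDiag_smul, ← congDiag_add, logDetBarrier_congDiag hW (by simpa using hh)]
  simp

lemma logDetBarrier_smul_one {c : ℝ} (hc : 0 < c) :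
    logDetBarrier (c • (1 : Mat d)) = -(d * Real.log c) := by
  have h := logDetBarrier_congDiag (W := (1 : Mat d)) isUnit_one (μ := fun _ => c) fun _ => hc
  have h1 : congDiag (1 : Mat d) (fun _ => c) = c • 1 := by
    have := congDiag_smul (1 : Mat d) c 1
    rw [congDiag_one] at this
    simpa [Pi.smul_def] using this
  rw [h1, congDiag_one] at h
  rw [h]
  simp [logDetBarrier]

lemma inv_smul_one {c : ℝ} (hc : 0 < c) : (c • (1 : Mat d))⁻¹ = c⁻¹ • 1 := by
  refine inv_eq_right_inv ?_
  rw [Matrix.smul_mul, Matrix.mul_smul, smul_smul, mul_inv_cancel₀ hc.ne']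
  simp

/-- The arithmetic-geometric mean inequality for the eigenvalues of a positive definite matrix. -/
lemma neg_logDetBarrier_le {P : Mat d} (hd : 0 < d) (hP : P.PosDef) :
    -logDetBarrier P ≤ d * Real.log (P.trace.re / d) := by
  have hd' : (0 : ℝ) < d := by exact_mod_cast hd
  have htr : 0 < P.trace.re := by
    have : Nonempty (Fin d) := ⟨⟨0, hd⟩⟩
    exact (Complex.lt_def.1 hP.trace_pos).1
  have hc : 0 < P.trace.re / d := by positivity
  have h := logDetBarrier_gradient_le (posDef_smul (PosDef.one (n := Fin d) (R := ℂ)) hc) hP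
  rw [logDetBarrier_smul_one hc, inv_smul_one hc, ip_smul_left, ip_sub_right, ip_comm 1 P,
    ip_one_right, ip_smul_right, ip_one_right] at h
  simp only [trace_one, Fintype.card_fin, Complex.natCast_re] at h
  rw [div_mul_cancel₀ _ hd'.ne'] at h
  simp at h
  linarith

lemma logDetBarrier_antitone {X Y : Mat d} (hX : X.PosDef) (h : (Y - X).PosSemidef) :
    logDetBarrier Y ≤ logDetBarrier X := by
  have hY : Y.PosDef := by simpa using hX.add_posSemidef h
  have h1 := logDetBarrier_gradient_le hY hX
  have h2 := ip_nonneg hY.inv.posSemidef h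
  rw [ip_sub_right] at h1 h2
  linarith

lemma logDetBarrier_le_of_smul_one_le {X : Mat d} {c : ℝ} (hc : 0 < c)
    (h : (X - c • 1).PosSemidef) : logDetBarrier X ≤ -(d * Real.log c) := by
  rw [← logDetBarrier_smul_one hc]
  exact logDetBarrier_antitone (posDef_smul PosDef.one hc) h

/-! ### The dual local norm -/

lemma ip_eq_sum (X Y : Mat d) : ip X Y = ∑ i, ∑ j, (X i j * Y j i).re := by
  simp [ip, Matrix.trace, Matrix.mul_apply, Complex.re_sum]

lemma ip_eq_sum_star {K : Mat d} (hK : K.IsHermitian) (X : Mat d) :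
    ip X K = ∑ i, ∑ j, (star (K i j) * X i j).re := by
  rw [ip_eq_sum]
  refine Finset.sum_congr rfl fun i _ => Finset.sum_congr rfl fun j _ => ?_
  rw [hK.apply j i, mul_comm]

lemma ip_self_eq_sum {K : Mat d} (hK : K.IsHermitian) :
    ip K K = ∑ i, ∑ j, Complex.normSq (K i j) := by
  rw [ip_eq_sum_star hK]
  refine Finset.sum_congr rfl fun i _ => Finset.sum_congr rfl fun j _ => ?_
  rw [Complex.star_def, ← Complex.normSq_eq_conj_mul_self, Complex.ofReal_re]

/-- The Cauchy-Schwarz inequality: the dual of the local norm at `X` is the local norm at `X⁻¹`. -/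
lemma abs_ip_le_localNorm_mul_localNorm_inv {X H K : Mat d} (hX : X.PosDef)
    (hH : H.IsHermitian) (hK : K.IsHermitian) :
    |ip H K| ≤ localNorm X H * localNorm X⁻¹ K := by
  have hinv := inv_inv_of_posDef hX
  have hK2 := localNorm_sq hX.inv hK
  rw [hinv] at hK2
  obtain ⟨W, l, hW, hXW, hl⟩ := exists_congDiag hX hH
  set N : Mat d := Wᴴ * K * W with hN
  have hNh : N.IsHermitian := isHermitian_conjTranspose_mul_mul W hK
  have h1 : ip (X * K * X) K = ip N N := by
    rw [hXW, congDiag_one, ip, ip, hN]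
    congr 1
    calc (W * Wᴴ * K * (W * Wᴴ) * K).trace
        = (W * (Wᴴ * K * W * (Wᴴ * K))).trace := by simp only [Matrix.mul_assoc]
      _ = _ := by rw [Matrix.trace_mul_comm]; simp only [Matrix.mul_assoc]
  have h2 : ∑ i, (N i i).re ^ 2 ≤ localNorm X⁻¹ K ^ 2 := by
    rw [hK2, h1, ip_self_eq_sum hNh]
    refine Finset.sum_le_sum fun i _ => ?_
    refine le_trans ?_ (Finset.single_le_sum (f := fun j => Complex.normSq (N i j))
      (fun j _ => Complex.normSq_nonneg _) (Finset.mem_univ i))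
    rw [Complex.normSq_apply]
    nlinarith [mul_self_nonneg (N i i).im]
  have h3 : ip H K = ∑ i, l i * (N i i).re := by rw [hl, ip_congDiag]
  have h4 : localNorm X H ^ 2 = ∑ i, l i ^ 2 := by rw [hXW, hl, localNorm_congDiag_sq hW]
  refine abs_le_of_sq_le_sq ?_ (mul_nonneg (localNorm_nonneg _ _) (localNorm_nonneg _ _))
  rw [h3, mul_pow, h4]
  refine (Finset.sum_mul_sq_le_sq_mul_sq _ _ _).trans ?_
  exact mul_le_mul_of_nonneg_left h2 (Finset.sum_nonneg fun i _ => sq_nonneg _)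

/-- The dual local norm of `X⁻¹ - Y⁻¹` at `X` is the local norm of `X - Y` at `Y`. -/
lemma localNorm_inv_sub_inv {X Y : Mat d} (hX : X.PosDef) (hY : Y.PosDef) :
    localNorm X⁻¹ (X⁻¹ - Y⁻¹) = localNorm Y (X - Y) := by
  have hXd := (isUnit_iff_isUnit_det _).1 hX.isUnit
  have hYd := (isUnit_iff_isUnit_det _).1 hY.isUnit
  rw [localNorm, localNorm, nonsing_inv_nonsing_inv _ hXd]
  congr 1
  rw [ip, ip]
  congr 1
  have h1 : X * (X⁻¹ - Y⁻¹) * X * (X⁻¹ - Y⁻¹) = (1 - X * Y⁻¹) * (1 - X * Y⁻¹) := by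
    rw [Matrix.mul_assoc (X * _), mul_sub X, mul_nonsing_inv _ hXd]
  have h2 : Y⁻¹ * (X - Y) * Y⁻¹ * (X - Y) = (Y⁻¹ * X - 1) * (Y⁻¹ * X - 1) := by
    rw [Matrix.mul_assoc (Y⁻¹ * _), mul_sub Y⁻¹, nonsing_inv_mul _ hYd]
  rw [h1, h2]
  have h3 : (Y⁻¹ * X * (Y⁻¹ * X)).trace = (X * Y⁻¹ * (X * Y⁻¹)).trace := by
    rw [Matrix.mul_assoc, Matrix.trace_mul_comm]
    simp only [Matrix.mul_assoc]
  simp only [mul_sub, sub_mul, Matrix.mul_one, Matrix.one_mul, Matrix.trace_sub, h3,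
    Matrix.trace_mul_comm Y⁻¹ X]
  ring

/-! ### The bias update -/

/-- In coordinates in which `X⁻¹` is the identity and `P` is diagonal, the bias update replaces
every eigenvalue below one by one. -/
lemma biasUpdate_eq_congDiag {P X : Mat d} (hP : P.PosDef) (hX : X.PosDef) :
    ∃ (W : Mat d) (m : Fin d → ℝ), IsUnit W ∧ (∀ i, 0 < m i) ∧ X⁻¹ = congDiag W 1 ∧
      P = congDiag W m ∧ biasUpdate P X = congDiag W (fun i => max (m i) 1) := by
  set S := msqrt X with hS
  have hSu : IsUnit S := isUnit_msqrt hX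
  have hSd : IsUnit S.det := (isUnit_iff_isUnit_det _).1 hSu
  have hSh : Sᴴ = S := msqrt_isHermitian X
  have hSi : (S⁻¹)ᴴ = S⁻¹ := by rw [conjTranspose_nonsing_inv, hSh]
  have hSS : S * S = X := msqrt_mul_self hX.posSemidef
  have hE : (1 - S * P * S).IsHermitian := by
    refine isHermitian_one.sub ?_
    rw [IsHermitian, conjTranspose_mul, conjTranspose_mul, hSh, hP.1.eq, Matrix.mul_assoc]
  obtain ⟨V, k, hV1, hV2, hk, hcfc⟩ := exists_unitary_cfc hE
  have hone : congDiag V 1 = 1 := by rw [congDiag_one, hV1]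
  have hconj : ∀ μ, congDiag (S⁻¹ * V) μ = S⁻¹ * congDiag V μ * S⁻¹ := fun μ => by
    simp only [congDiag, conjTranspose_mul, hSi, Matrix.mul_assoc]
  have hWu : IsUnit (S⁻¹ * V) :=
    ((isUnit_nonsing_inv_iff).2 hSu).mul (IsUnit.of_mul_eq_one _ hV1)
  have hPW : P = congDiag (S⁻¹ * V) (1 - k) := by
    rw [hconj, congDiag_sub, hone, ← hk]
    calc P = (S⁻¹ * S) * P * (S * S⁻¹) := by
          rw [mul_nonsing_inv _ hSd, nonsing_inv_mul _ hSd]; simp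
      _ = S⁻¹ * (S * P * S) * S⁻¹ := by simp only [Matrix.mul_assoc]
      _ = _ := by rw [sub_sub_cancel]
  refine ⟨S⁻¹ * V, 1 - k, hWu, ?_, ?_, hPW, ?_⟩
  · rw [hPW] at hP
    exact (posDef_congDiag_iff hWu).1 hP
  · rw [hconj, hone, Matrix.mul_one, ← Matrix.mul_inv_rev, hSS]
  · rw [biasUpdate, mpos, hcfc, ← hS, ← hconj]
    nth_rewrite 1 [hPW]
    rw [← congDiag_add]
    congr 1
    ext i
    simp only [Pi.add_apply, Pi.sub_apply, Pi.one_apply, Function.comp_apply]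
    rw [← max_add_add_left]
    simp [max_comm]

lemma biasUpdate_posDef {P X : Mat d} (hP : P.PosDef) (hX : X.PosDef) :
    (biasUpdate P X).PosDef := by
  obtain ⟨W, m, hW, hm, -, -, h⟩ := biasUpdate_eq_congDiag hP hX
  rw [h, posDef_congDiag_iff hW]
  exact fun i => lt_max_of_lt_right one_pos

lemma biasUpdate_sub_posSemidef {P X : Mat d} (hP : P.PosDef) (hX : X.PosDef) :
    (biasUpdate P X - P).PosSemidef := by
  obtain ⟨W, m, hW, hm, -, hPW, h⟩ := biasUpdate_eq_congDiag hP hX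
  rw [h]
  nth_rewrite 1 [hPW]
  rw [← congDiag_sub]
  exact posSemidef_congDiag fun i => by simp

lemma biasUpdate_sub_inv_posSemidef {P X : Mat d} (hP : P.PosDef) (hX : X.PosDef) :
    (biasUpdate P X - X⁻¹).PosSemidef := by
  obtain ⟨W, m, hW, hm, hXW, hPW, h⟩ := biasUpdate_eq_congDiag hP hX
  rw [h, hXW, ← congDiag_sub]
  exact posSemidef_congDiag fun i => by simp

/-- The log-determinant of the bias matrix pays for the bias that the update introduces at the
played point, with a second-order surplus. -/
lemma ip_biasUpdate_sub_le {P X : Mat d} (hP : P.PosDef) (hX : X.PosDef) :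
    ip X (biasUpdate P X - P) + localNorm X⁻¹ (biasUpdate P X - P) ^ 2 / 2
      ≤ logDetBarrier P - logDetBarrier (biasUpdate P X) := by
  have hXi := inv_inv_of_posDef hX
  obtain ⟨W, m, hW, hm, hXW, hPW, h⟩ := biasUpdate_eq_congDiag hP hX
  have hD : biasUpdate P X - P = congDiag W ((fun i => max (m i) 1) - m) := by
    rw [h, congDiag_sub, ← hPW]
  have h1 : ip X (biasUpdate P X - P) = ∑ i, (max (m i) 1 - m i) := by
    rw [hD, ← hXi, hXW, ip_inv_congDiag hW]
    rfl
  have h2 : localNorm X⁻¹ (biasUpdate P X - P) ^ 2 = ∑ i, (max (m i) 1 - m i) ^ 2 := by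
    rw [hD, hXW, localNorm_congDiag_sq hW]
    rfl
  rw [h1, h2, h]
  nth_rewrite 1 [hPW]
  rw [logDetBarrier_congDiag hW hm, logDetBarrier_congDiag hW fun i => lt_max_of_lt_right one_pos]
  have key : ∀ i, (max (m i) 1 - m i) + (max (m i) 1 - m i) ^ 2 / 2
      ≤ Real.log (max (m i) 1) - Real.log (m i) := by
    intro i
    rcases le_total 1 (m i) with h1 | h1
    · simp [max_eq_left h1]
    · have := half_sq_le_sub_log (t := m i - 1) (by linarith [hm i]) (by linarith)
      rw [max_eq_right h1, Real.log_one]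
      rw [add_sub_cancel] at this
      nlinarith
  have := Finset.sum_le_sum fun i (_ : i ∈ Finset.univ) => key i
  rw [Finset.sum_add_distrib, ← Finset.sum_div,
    Finset.sum_sub_distrib (fun i => Real.log (max (m i) 1))] at this
  linarith

/-- If `P` dominates `Y⁻¹`, then the bias update at `X` is at most as large as the step from `Y`
to `X`. -/
lemma localNorm_biasUpdate_sub_le {P X Y : Mat d} (hP : P.PosDef) (hX : X.PosDef)
    (hY : Y.PosDef) (hPY : (P - Y⁻¹).PosSemidef) :
    localNorm X⁻¹ (biasUpdate P X - P) ≤ localNorm Y (X - Y) := by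
  have hXi := inv_inv_of_posDef hX
  obtain ⟨W, m, hW, hm, hXW, hPW, h⟩ := biasUpdate_eq_congDiag hP hX
  set n : Fin d → ℝ := (fun i => max (m i) 1) - m with hn
  have hn0 : ∀ i, 0 ≤ n i := fun i => by simp [hn]
  have hD : biasUpdate P X - P = congDiag W n := by
    rw [h, congDiag_sub, ← hPW]
  have hXV : X = congDiag (dualCong W) 1 := by rw [← inv_congDiag_one hW, ← hXW, hXi]
  set N := localNorm X⁻¹ (biasUpdate P X - P) with hN
  have hN2 : N ^ 2 = ∑ i, n i ^ 2 := by
    rw [hN, hD, hXW, localNorm_congDiag_sq hW]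
  have hVn : localNorm X (congDiag (dualCong W) n) = N := by
    rw [← sq_eq_sq₀ (localNorm_nonneg _ _) (localNorm_nonneg _ _), hN2, hXV,
      localNorm_congDiag_sq (isUnit_dualCong hW)]
  have hVpsd : (congDiag (dualCong W) n).PosSemidef := posSemidef_congDiag hn0
  -- `n` vanishes where `m ≥ 1`, hence `n² = n (1 - m)`
  have h1 : N ^ 2 = ip (congDiag (dualCong W) n) (X⁻¹ - P) := by
    rw [hXW, hPW, ← congDiag_sub, ip_congDiag_dual (dualCong_mul hW), hN2]
    refine Finset.sum_congr rfl fun i _ => ?_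
    simp only [hn, Pi.sub_apply, Pi.one_apply]
    rcases le_total 1 (m i) with h1 | h1
    · simp [max_eq_left h1]
    · rw [max_eq_right h1]; ring
  have h2 : N ^ 2 ≤ ip (congDiag (dualCong W) n) (X⁻¹ - Y⁻¹) := by
    have := ip_nonneg hVpsd hPY
    rw [h1]
    simp only [ip_sub_right] at this ⊢
    linarith
  have h3 := (le_abs_self _).trans (abs_ip_le_localNorm_mul_localNorm_inv hX hVpsd.1
    (hX.inv.1.sub hY.inv.1))
  rw [hVn, localNorm_inv_sub_inv hX hY] at h3
  have hN0 : 0 ≤ N := localNorm_nonneg _ _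
  rcases hN0.eq_or_lt with h0 | h0
  · rw [← h0]; exact localNorm_nonneg _ _
  · exact le_of_mul_le_mul_left (by nlinarith) h0

/-! ### Density matrices -/

lemma pdDensity_subset {X : Mat d} (hX : X ∈ pdDensityMatrices d) : X ∈ densityMatrices d :=
  ⟨hX.1.posSemidef, hX.2⟩

lemma trace_re_of_density {X : Mat d} (hX : X ∈ densityMatrices d) : X.trace.re = 1 := by
  rw [hX.2]; rfl

lemma ip_one_of_density {X : Mat d} (hX : X ∈ densityMatrices d) : ip X 1 = 1 := by
  rw [ip_one_right, trace_re_of_density hX]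

lemma ip_self_le_one {X : Mat d} (hX : X ∈ densityMatrices d) : ip X X ≤ 1 := by
  have h1 := localNorm_sq PosDef.one hX.1.1
  have h2 := (le_abs_self _).trans (abs_ip_le_localNorm_mul PosDef.one hX.1.1 hX.1)
  simp only [inv_one, Matrix.one_mul, Matrix.mul_one] at h1
  rw [ip_comm 1, ip_one_of_density hX, ← h1] at h2
  have h3 := localNorm_nonneg (1 : Mat d) X
  rw [← h1]
  nlinarith

lemma mix_mem_pdDensity {X Y : Mat d} (hX : X ∈ pdDensityMatrices d)
    (hY : Y ∈ densityMatrices d) {h : ℝ} (h0 : 0 ≤ h) (h1 : h < 1) :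
    X + h • (Y - X) ∈ pdDensityMatrices d := by
  have he : X + h • (Y - X) = (1 - h) • X + h • Y := by
    rw [smul_sub, sub_smul, one_smul]; abel
  refine ⟨?_, ?_⟩
  · rw [he]
    exact (posDef_smul hX.1 (by linarith)).add_posSemidef (posSemidef_smul hY.1 h0)
  · rw [Matrix.trace_add, Matrix.trace_smul, Matrix.trace_sub, hX.2, hY.2]
    simp

/-- The maximally mixed state `I / d`. -/
noncomputable def mixedState (d : ℕ) : Mat d := (d : ℝ)⁻¹ • 1

lemma mixedState_mem (hd : 0 < d) : mixedState d ∈ pdDensityMatrices d := by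
  have hd' : (0 : ℝ) < d := by exact_mod_cast hd
  refine ⟨posDef_smul PosDef.one (by positivity), ?_⟩
  rw [mixedState, Matrix.trace_smul, Matrix.trace_one, Fintype.card_fin]
  have : (d : ℂ) ≠ 0 := by exact_mod_cast hd.ne'
  simp [this]

lemma isCompact_densityMatrices (d : ℕ) : IsCompact (densityMatrices d) := by
  have hK : IsCompact {X : Mat d | ∀ i j, X i j ∈ Metric.closedBall (0 : ℂ) 1} := by
    have := isCompact_univ_pi (fun _ : Fin d => isCompact_univ_pi
      (fun _ : Fin d => isCompact_closedBall (0 : ℂ) 1))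
    refine this.of_isClosed_subset ?_ fun X hX i _ j _ => hX i j
    simp only [Set.ofPred_forall]
    exact isClosed_iInter fun i => isClosed_iInter fun j =>
      Metric.isClosed_closedBall.preimage (by fun_prop)
  refine hK.of_isClosed_subset ?_ ?_
  · have h1 : densityMatrices d = {X : Mat d | Xᴴ = X} ∩
        (⋂ x : Fin d → ℂ, {X : Mat d | 0 ≤ star x ⬝ᵥ (X *ᵥ x)}) ∩ {X : Mat d | X.trace = 1} := by
      ext X
      simp only [densityMatrices, Set.mem_ofPred_eq, posSemidef_iff_dotProduct_mulVec,
        Set.mem_inter_iff, Set.mem_iInter]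
      rfl
    rw [h1]
    refine (IsClosed.inter ?_ (isClosed_iInter fun x => ?_)).inter ?_
    · exact isClosed_eq (by fun_prop) continuous_id
    · have hc : Continuous fun X : Mat d => star x ⬝ᵥ (X *ᵥ x) := by fun_prop
      have h2 : {X : Mat d | 0 ≤ star x ⬝ᵥ (X *ᵥ x)} =
          {X : Mat d | 0 ≤ (star x ⬝ᵥ (X *ᵥ x)).re} ∩
            {X : Mat d | 0 = (star x ⬝ᵥ (X *ᵥ x)).im} := by
        ext X
        simp [Complex.le_def]
      rw [h2]
      exact (isClosed_le continuous_const (Complex.continuous_re.comp hc)).inter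
        (isClosed_eq continuous_const (Complex.continuous_im.comp hc))
    · exact isClosed_eq (by fun_prop) continuous_const
  · intro X hX i j
    rw [mem_closedBall_zero_iff]
    have h1 := ip_self_le_one hX
    rw [ip_self_eq_sum hX.1.1] at h1
    have h2 := (Finset.single_le_sum (f := fun j => Complex.normSq (X i j))
      (fun j _ => Complex.normSq_nonneg _) (Finset.mem_univ j)).trans
      ((Finset.single_le_sum (f := fun i => ∑ j, Complex.normSq (X i j))
      (fun i _ => Finset.sum_nonneg fun j _ => Complex.normSq_nonneg _) (Finset.mem_univ i)))
    have h3 : ‖X i j‖ ^ 2 ≤ 1 := by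
      rw [← Complex.normSq_eq_norm_sq]
      exact h2.trans h1
    nlinarith [norm_nonneg (X i j)]

/-! ### Minimizers of barrier-regularized objectives -/

/-- `X` minimizes `F` over the positive definite density matrices. -/
def IsMinimizer (F : Mat d → ℝ) (X : Mat d) : Prop :=
  X ∈ pdDensityMatrices d ∧ ∀ Y ∈ pdDensityMatrices d, F X ≤ F Y

lemma exists_isMinimizer (hd : 0 < d) {c : ℝ} (hc : 0 < c) {Q : Mat d → ℝ} (hQ : Continuous Q) :
    ∃ X, IsMinimizer (fun Y => c * logDetBarrier Y + Q Y) X := by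
  set F : Mat d → ℝ := fun Y => c * logDetBarrier Y + Q Y with hF
  have hX0 := mixedState_mem hd
  set X₀ := mixedState d
  obtain ⟨Xm, -, hm⟩ := (isCompact_densityMatrices d).exists_isMinOn
    ⟨X₀, pdDensity_subset hX0⟩ hQ.continuousOn
  -- below this determinant the barrier alone exceeds the value of the objective at `X₀`
  set δ : ℝ := Real.exp (-((F X₀ - Q Xm) / c)) with hδ
  have hδ0 : 0 < δ := Real.exp_pos _
  have hdet : Continuous fun X : Mat d => X.det.re := Complex.continuous_re.comp (by fun_prop)
  set K : Set (Mat d) := densityMatrices d ∩ {X | δ ≤ X.det.re} with hK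
  have hKc : IsCompact K :=
    (isCompact_densityMatrices d).inter_right (isClosed_le continuous_const hdet)
  have hKpd : ∀ X ∈ K, X ∈ pdDensityMatrices d := fun X hX => by
    refine ⟨?_, hX.1.2⟩
    rw [hX.1.1.posDef_iff_det_ne_zero]
    intro h
    have := hX.2
    simp only [Set.mem_ofPred_eq, h, Complex.zero_re] at this
    linarith
  have hout : ∀ Y ∈ pdDensityMatrices d, Y ∉ K → F X₀ < F Y := by
    intro Y hY hYK
    have h1 : Y.det.re < δ := by
      by_contra h
      exact hYK ⟨pdDensity_subset hY, not_lt.1 h⟩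
    have h2 : 0 < Y.det.re := (Complex.lt_def.1 hY.1.det_pos).1
    have h3 : Real.log Y.det.re < -((F X₀ - Q Xm) / c) := by
      rw [Real.log_lt_iff_lt_exp h2]
      exact h1
    have h4 : Q Xm ≤ Q Y := hm (pdDensity_subset hY)
    have h5 : F X₀ - Q Xm < c * logDetBarrier Y := by
      rw [logDetBarrier, mul_comm, ← div_lt_iff₀ hc]
      linarith
    simp only [hF] at h5 ⊢
    linarith
  have hX0K : X₀ ∈ K := by
    by_contra h
    exact lt_irrefl _ (hout X₀ hX0 h)
  have hFc : ContinuousOn F K := by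
    refine ContinuousOn.add (continuousOn_const.mul ?_) hQ.continuousOn
    refine (ContinuousOn.log hdet.continuousOn fun X hX => ?_).neg
    have : δ ≤ X.det.re := hX.2
    linarith
  obtain ⟨X, hXK, hX⟩ := hKc.exists_isMinOn ⟨X₀, hX0K⟩ hFc
  refine ⟨X, hKpd X hXK, fun Y hY => ?_⟩
  by_cases hYK : Y ∈ K
  · exact hX hYK
  · exact (hX hX0K).trans (hout Y hY hYK).le

lemma isMinimizer_argminDensity {F : Mat d → ℝ} (h : ∃ X, IsMinimizer F X) :
    IsMinimizer F (argminDensity F) :=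
  Classical.epsilon_spec h

/-- First-order optimality: the directional derivative at a minimizer is nonnegative toward every
density matrix, including the singular ones. -/
lemma IsMinimizer.first_order {c : ℝ} {Q : Mat d → ℝ} {X Y : Mat d}
    (hX : IsMinimizer (fun Z => c * logDetBarrier Z + Q Z) X)
    (hY : Y ∈ densityMatrices d) {l q : ℝ}
    (hQ : ∀ h : ℝ, Q (X + h • (Y - X)) = Q X + h * l + h ^ 2 * q) :
    c * ip X⁻¹ (Y - X) ≤ l := by
  have hd := hasDerivAt_logDetBarrier hX.1.1 (hY.1.1.sub hX.1.1.1)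
  have hφ : HasDerivAt (fun h : ℝ => c * logDetBarrier (X + h • (Y - X)) + Q (X + h • (Y - X)))
      (c * -ip X⁻¹ (Y - X) + l) 0 := by
    refine (hd.const_mul c).add ?_
    simp only [hQ]
    have h1 : HasDerivAt (fun h : ℝ => Q X + h * l + h ^ 2 * q) (1 * l + (2 * 0 ^ 1 * 1) * q) 0 := by
      have h2 := ((hasDerivAt_id (0 : ℝ)).mul_const l).const_add (Q X)
      have h3 := ((hasDerivAt_id (0 : ℝ)).pow 2).mul_const q
      exact (h2.add h3).congr_deriv (by simp)
    exact h1.congr_deriv (by simp)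
  have ht := (hasDerivAt_iff_tendsto_slope.1 hφ).mono_left
    (nhdsWithin_mono (0 : ℝ) (s := Set.Ioi 0) (fun x (hx : 0 < x) => hx.ne'))
  have : 0 ≤ c * -ip X⁻¹ (Y - X) + l := by
    refine ge_of_tendsto ht ?_
    have hlt : Set.Ioo (0 : ℝ) 1 ∈ nhdsWithin (0 : ℝ) (Set.Ioi 0) :=
      Ioo_mem_nhdsGT one_pos
    filter_upwards [hlt] with h hh
    rw [slope_def_field]
    refine div_nonneg ?_ (by linarith [hh.1])
    have := hX.2 _ (mix_mem_pdDensity hX.1 hY hh.1.le hh.2)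
    simp only [zero_smul, add_zero]
    linarith
  linarith

/-- The objective grows away from its minimizer at least like the Bregman divergence of the barrier
plus the quadratic part of the losses. -/
lemma IsMinimizer.growth {c : ℝ} (hc : 0 ≤ c) {Q : Mat d → ℝ} {X Y : Mat d}
    (hX : IsMinimizer (fun Z => c * logDetBarrier Z + Q Z) X)
    (hY : Y ∈ pdDensityMatrices d) {l q : ℝ}
    (hQ : ∀ h : ℝ, Q (X + h • (Y - X)) = Q X + h * l + h ^ 2 * q) :
    c * (localNorm X (Y - X) ^ 2 / (2 * (1 + localNorm X (Y - X)))) + q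
      ≤ (c * logDetBarrier Y + Q Y) - (c * logDetBarrier X + Q X) := by
  have h1 := hX.first_order (pdDensity_subset hY) hQ
  have h2 := mul_le_mul_of_nonneg_left (logDetBarrier_bregman hX.1.1 hY.1) hc
  have h3 := hQ 1
  rw [one_smul, add_sub_cancel] at h3
  rw [h3]
  linarith

/-! ### The elliptic potential lemma -/

lemma ip_sum_left {ι : Type*} (s : Finset ι) (f : ι → Mat d) (Y : Mat d) :
    ip (∑ i ∈ s, f i) Y = ∑ i ∈ s, ip (f i) Y := by
  simp [ip, Finset.sum_mul, Matrix.trace_sum, Complex.re_sum]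

/-- The entries of a matrix as one long vector. -/
def vecMat (K : Mat d) : Fin (d * d) → ℂ :=
  fun k => K (finProdFinEquiv.symm k).1 (finProdFinEquiv.symm k).2

lemma star_vecMat_dotProduct {G H : Mat d} (hG : G.IsHermitian) (hH : H.IsHermitian) :
    star (vecMat G) ⬝ᵥ vecMat H = ((ip H G : ℝ) : ℂ) := by
  have h1 : star (vecMat G) ⬝ᵥ vecMat H = (G * H).trace := by
    rw [Matrix.trace, dotProduct, ← finProdFinEquiv.sum_comp, Fintype.sum_prod_type]
    simp only [vecMat, Pi.star_apply, Equiv.symm_apply_apply, Matrix.diag_apply, Matrix.mul_apply]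
    rw [Finset.sum_comm]
    refine Finset.sum_congr rfl fun i _ => Finset.sum_congr rfl fun j _ => ?_
    rw [hG.apply i j]
  have h2 : star (G * H).trace = (G * H).trace := by
    rw [← Matrix.trace_conjTranspose, conjTranspose_mul, hG.eq, hH.eq, Matrix.trace_mul_comm]
  rw [h1, ip, Matrix.trace_mul_comm H G]
  exact (Complex.conj_eq_iff_re.1 h2).symm

lemma ip_vecMulVec {n : ℕ} (A : Mat n) (v : Fin n → ℂ) :
    ip A (vecMulVec v (star v)) = (star v ⬝ᵥ (A *ᵥ v)).re := by
  rw [ip, mul_vecMulVec, trace_vecMulVec, dotProduct_comm]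

lemma ip_vecMulVec_vecMat {G H : Mat d} (hG : G.IsHermitian) (hH : H.IsHermitian) :
    ip (vecMulVec (vecMat G) (star (vecMat G))) (vecMulVec (vecMat H) (star (vecMat H)))
      = ip H G ^ 2 := by
  rw [ip, vecMulVec_mul_vecMulVec, trace_vecMulVec, star_vecMat_dotProduct hG hH, dotProduct_comm,
    smul_dotProduct, star_vecMat_dotProduct hH hG, ip_comm G H, smul_eq_mul, ← Complex.ofReal_mul,
    Complex.ofReal_re, sq]

/-- Fenchel's inequality for the quadratic form of `A`. -/
lemma neg_dotProduct_sub_le {n : ℕ} {A : Mat n} (hA : A.PosDef) (v h : Fin n → ℂ) :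
    -(star v ⬝ᵥ h).re - (star h ⬝ᵥ (A *ᵥ h)).re / 2 ≤ (star v ⬝ᵥ (A⁻¹ *ᵥ v)).re / 2 := by
  have hAd := (isUnit_iff_isUnit_det _).1 hA.isUnit
  obtain ⟨w, hw⟩ : ∃ w, w = A⁻¹ *ᵥ v := ⟨_, rfl⟩
  rw [← hw]
  have hAw : A *ᵥ w = v := by
    rw [hw, mulVec_mulVec, mul_nonsing_inv _ hAd, one_mulVec]
  have hwA : star w ⬝ᵥ (A *ᵥ h) = star v ⬝ᵥ h := by
    rw [dotProduct_mulVec, ← hAw, star_mulVec, hA.1.eq]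
  have hconj : ∀ x y : Fin n → ℂ, (star x ⬝ᵥ y).re = (star y ⬝ᵥ x).re := fun x y => by
    rw [← Complex.conj_re, ← Complex.star_def, ← star_dotProduct_star, star_star, dotProduct_comm]
  have h0 := (Complex.le_def.1 (hA.posSemidef.dotProduct_mulVec_nonneg (h + w))).1
  rw [mulVec_add, hAw, star_add, add_dotProduct, dotProduct_add, dotProduct_add, hwA] at h0
  simp only [Complex.add_re, Complex.zero_re] at h0
  rw [hconj h v, hconj w v] at h0
  linarith

/-- The elliptic potential lemma in the space of Hermitian matrices, whose real dimension is `d²`: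
whatever the moves `H s` are, what the linear losses `G s` gain over the accumulated quadratic
losses is logarithmic. -/
lemma sum_linear_sub_quadratic_le (hd : 0 < d) {c β : ℝ} (hc : 0 < c) (hβ : 0 < β)
    {G H : ℕ → Mat d} {n : ℕ} (hG : ∀ s < n, (G s).IsHermitian)
    (hH : ∀ s < n, (H s).IsHermitian) :
    ∑ s ∈ Finset.range n, (-ip (H s) (G s) -
        (c * ip (H s) (H s) + β * ∑ r ∈ Finset.range (s + 1), ip (H s) (G r) ^ 2) / 2)
      ≤ (d : ℝ) ^ 2 / (2 * β) *
        Real.log (1 + β / (c * d ^ 2) * ∑ s ∈ Finset.range n, ip (G s) (G s)) := by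
  have hN : 0 < d * d := Nat.mul_pos hd hd
  have hd' : (0 : ℝ) < d := by exact_mod_cast hd
  set V : ℕ → Mat (d * d) := fun s => vecMulVec (vecMat (G s)) (star (vecMat (G s))) with hV
  set A : ℕ → Mat (d * d) := fun k => c • 1 + ∑ r ∈ Finset.range k, β • V r with hA
  have hVpsd : ∀ s, (V s).PosSemidef := fun s => posSemidef_vecMulVec_self_star _
  have hApd : ∀ k, (A k).PosDef := fun k =>
    (posDef_smul PosDef.one hc).add_posSemidef
      (posSemidef_sum _ fun r _ => posSemidef_smul (hVpsd r) hβ.le)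
  have hAsucc : ∀ k, A k - A (k + 1) = -(β • V k) := fun k => by
    simp only [hA, Finset.sum_range_succ]; abel
  -- up to the factor two, the quadratic losses of round `s` are the quadratic form of `A (s + 1)`
  have hquad : ∀ s < n, (star (vecMat (H s)) ⬝ᵥ (A (s + 1) *ᵥ vecMat (H s))).re
      = c * ip (H s) (H s) + β * ∑ r ∈ Finset.range (s + 1), ip (H s) (G r) ^ 2 := by
    intro s hs
    rw [← ip_vecMulVec, hA]
    simp only
    rw [ip_add_left, ip_smul_left, ip_comm 1, ip_one_right, trace_vecMulVec, dotProduct_comm,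
      star_vecMat_dotProduct (hH s hs) (hH s hs), Complex.ofReal_re, ← Finset.smul_sum,
      ip_smul_left, ip_sum_left]
    congr 2
    refine Finset.sum_congr rfl fun r hr => ?_
    have hrn : r < n := by
      have := Finset.mem_range.1 hr
      omega
    exact ip_vecMulVec_vecMat (hG r hrn) (hH s hs)
  have hstep : ∀ s ∈ Finset.range n, -ip (H s) (G s) -
      (c * ip (H s) (H s) + β * ∑ r ∈ Finset.range (s + 1), ip (H s) (G r) ^ 2) / 2
      ≤ 1 / (2 * β) * (logDetBarrier (A s) - logDetBarrier (A (s + 1))) := by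
    intro s hs
    have hs := Finset.mem_range.1 hs
    have h1 := neg_dotProduct_sub_le (hApd (s + 1)) (vecMat (G s)) (vecMat (H s))
    rw [hquad s hs, star_vecMat_dotProduct (hG s hs) (hH s hs), Complex.ofReal_re,
      ← ip_vecMulVec] at h1
    -- concavity of `log det` turns the dual norm of `G s` into an increment of `log det A`
    have h2 := logDetBarrier_gradient_le (hApd (s + 1)) (hApd s)
    rw [hAsucc, ← neg_smul, ip_smul_right] at h2
    have h3 : ip (A (s + 1))⁻¹ (V s) / 2
        ≤ 1 / (2 * β) * (logDetBarrier (A s) - logDetBarrier (A (s + 1))) := by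
      rw [one_div, inv_mul_eq_div, le_div_iff₀ (by positivity)]
      linarith
    exact h1.trans h3
  refine (Finset.sum_le_sum hstep).trans ?_
  rw [← Finset.mul_sum, Finset.sum_range_sub']
  have hA0 : logDetBarrier (A 0) = -((d * d : ℕ) * Real.log c) := by
    rw [← logDetBarrier_smul_one hc]
    simp [hA]
  have htr : (A n).trace.re = c * (d * d) + β * ∑ s ∈ Finset.range n, ip (G s) (G s) := by
    simp only [hA, Matrix.trace_add, Matrix.trace_smul, Matrix.trace_sum, Matrix.trace_one]
    simp only [Complex.add_re, Complex.re_sum, Complex.smul_re, Finset.mul_sum, smul_eq_mul]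
    congr 1
    · simp
    · refine Finset.sum_congr rfl fun s hs => ?_
      rw [hV]
      simp only
      rw [trace_vecMulVec, dotProduct_comm, star_vecMat_dotProduct
        (hG s (Finset.mem_range.1 hs)) (hG s (Finset.mem_range.1 hs)), Complex.ofReal_re]
  have hS : 0 ≤ ∑ s ∈ Finset.range n, ip (G s) (G s) := Finset.sum_nonneg fun s hs => by
    rw [ip_self_eq_sum (hG s (Finset.mem_range.1 hs))]
    exact Finset.sum_nonneg fun i _ => Finset.sum_nonneg fun j _ => Complex.normSq_nonneg _
  have h3 := neg_logDetBarrier_le hN (hApd n)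
  have hratio : (A n).trace.re / ((d * d : ℕ) : ℝ)
      = c * (1 + β / (c * d ^ 2) * ∑ s ∈ Finset.range n, ip (G s) (G s)) := by
    rw [htr]
    push_cast
    field_simp
  rw [hratio, Real.log_mul hc.ne' (by positivity)] at h3
  rw [hA0]
  have h4 : (d : ℝ) ^ 2 / (2 * β) = 1 / (2 * β) * (d : ℝ) ^ 2 := by ring
  rw [h4, mul_assoc]
  refine mul_le_mul_of_nonneg_left ?_ (by positivity)
  push_cast at h3 ⊢
  rw [mul_add] at h3
  rw [sq] at h3 ⊢
  linarith

/-! ### Trace and Loewner-order estimates -/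

lemma trace_smul_one_sub_posSemidef {A : Mat d} (hA : A.PosSemidef) :
    (A.trace.re • (1 : Mat d) - A).PosSemidef := by
  obtain ⟨W, l, hW, h1, rfl⟩ := exists_congDiag PosDef.one hA.1
  have hl := (posSemidef_congDiag_iff hW).1 hA
  have htr : (congDiag W l).trace.re = ∑ i, l i := by
    rw [← ip_one_right, ip_comm]
    nth_rewrite 1 [← inv_one]
    rw [h1, ip_inv_congDiag hW]
  rw [htr]
  nth_rewrite 1 [h1]
  rw [← congDiag_smul, ← congDiag_sub]
  refine posSemidef_congDiag fun i => ?_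
  simpa using Finset.single_le_sum (f := l) (fun i _ => hl i) (Finset.mem_univ i)

lemma ip_self_le_trace_sq {R : Mat d} (hR : R.PosSemidef) : ip R R ≤ R.trace.re ^ 2 := by
  have h := ip_mono_left (trace_smul_one_sub_posSemidef hR) hR
  rw [ip_smul_left, ip_comm 1, ip_one_right] at h
  rwa [sq]

lemma trace_le_trace_inv_mul_ip {X R : Mat d} (hd : 0 < d) (hX : X.PosDef) (hR : R.PosSemidef) :
    R.trace.re ≤ X⁻¹.trace.re * ip X R := by
  have : Nonempty (Fin d) := ⟨⟨0, hd⟩⟩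
  have htr : 0 < X⁻¹.trace.re := (Complex.lt_def.1 hX.inv.trace_pos).1
  have h1 := inv_sub_inv_posSemidef hX.inv (trace_smul_one_sub_posSemidef hX.inv.posSemidef)
  rw [inv_inv_of_posDef hX, inv_smul_one htr] at h1
  have h2 := ip_mono_left h1 hR
  rw [ip_smul_left, ip_comm 1, ip_one_right, inv_mul_le_iff₀ htr] at h2
  exact h2

lemma trace_re_mono {X Y : Mat d} (h : (Y - X).PosSemidef) : X.trace.re ≤ Y.trace.re := by
  have := trace_re_nonneg h
  rw [Matrix.trace_sub, Complex.sub_re] at this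
  linarith

/-- If `U ≺ k P⁻¹` fails, then `U` has a large inner product with `P`. -/
lemma le_ip_of_not_posDef {U P : Mat d} (hU : U.PosSemidef) (hP : P.PosDef) {k : ℝ}
    (h : ¬ (k • P⁻¹ - U).PosDef) : k ≤ ip U P := by
  by_contra hlt
  rw [not_le] at hlt
  refine h ?_
  obtain ⟨W, l, hW, h1, rfl⟩ := exists_congDiag hP.inv hU.1
  have hl := (posSemidef_congDiag_iff hW).1 hU
  rw [h1, ← congDiag_smul, ← congDiag_sub, posDef_congDiag_iff hW]
  intro i
  rw [ip_comm, ← inv_inv_of_posDef hP, h1, ip_inv_congDiag hW] at hlt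
  have := Finset.single_le_sum (f := l) (fun i _ => hl i) (Finset.mem_univ i)
  simp
  linarith

lemma ip_le_of_posDef_sub {U P X R : Mat d} {k : ℝ} (hk : 0 ≤ k) (hX : X.PosDef)
    (h : (k • P⁻¹ - U).PosDef) (hPX : (P - X⁻¹).PosSemidef) (hR : R.PosSemidef) :
    ip U R ≤ k * ip X R := by
  have h1 := ip_mono_left h.posSemidef hR
  have h2 := inv_sub_inv_posSemidef hX.inv hPX
  rw [inv_inv_of_posDef hX] at h2
  have h3 := ip_mono_left h2 hR
  rw [ip_smul_left] at h1
  exact h1.trans (mul_le_mul_of_nonneg_left h3 hk)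

lemma eq_zero_of_localNorm_eq_zero {X H : Mat d} (hX : X.PosDef) (hH : H.IsHermitian)
    (h : localNorm X H = 0) : H = 0 := by
  obtain ⟨W, l, hW, rfl, rfl⟩ := exists_congDiag hX hH
  have h1 := localNorm_congDiag_sq hW l
  rw [h] at h1
  have h2 := (Finset.sum_eq_zero_iff_of_nonneg fun i _ => sq_nonneg (l i)).1
    (by rw [← h1]; simp)
  have h3 : l = 0 := by
    ext i
    simpa using h2 i (Finset.mem_univ i)
  simp [h3, congDiag]

/-- Density matrices are at most the identity, so their local norms dominate the Frobenius norm. -/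
lemma ip_self_le_localNorm_sq {X K : Mat d} (hX : X ∈ pdDensityMatrices d)
    (hK : K.IsHermitian) : ip K K ≤ localNorm X K ^ 2 := by
  obtain ⟨W, l, hW, hXW, hl⟩ := exists_congDiag hX.1 hK
  rw [hXW, hl, localNorm_congDiag_sq hW]
  -- the Gram matrix `Wᴴ W` has the trace of `W Wᴴ = X`, so it is a density matrix as well
  set G : Mat d := Wᴴ * W with hG
  have hGd : G ∈ densityMatrices d := by
    refine ⟨posSemidef_conjTranspose_mul_self W, ?_⟩
    rw [hG, Matrix.trace_mul_comm, ← congDiag_one, ← hXW, hX.2]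
  have hG1 := ip_self_le_one hGd
  rw [ip_self_eq_sum hGd.1.1] at hG1
  have hrow : ∀ i, ∑ j, Complex.normSq (G i j) ≤ 1 := fun i =>
    (Finset.single_le_sum (f := fun i => ∑ j, Complex.normSq (G i j))
      (fun i _ => Finset.sum_nonneg fun j _ => Complex.normSq_nonneg _)
      (Finset.mem_univ i)).trans hG1
  have hsymm : ∀ i j, Complex.normSq (G j i) = Complex.normSq (G i j) := fun i j => by
    rw [← hGd.1.1.apply i j, Complex.star_def, Complex.normSq_conj]
  have hmid : Wᴴ * congDiag W l * W = G * diagonal (fun i => (l i : ℂ)) * G := by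
    simp only [congDiag, hG, Matrix.mul_assoc]
  have hentry : ∀ i, ((Wᴴ * congDiag W l * W) i i).re = ∑ j, l j * Complex.normSq (G i j) := by
    intro i
    rw [hmid, Matrix.mul_apply, Complex.re_sum]
    refine Finset.sum_congr rfl fun j _ => ?_
    rw [Matrix.mul_diagonal, ← hGd.1.1.apply j i, Complex.star_def, mul_right_comm,
      Complex.mul_conj, ← Complex.ofReal_mul, Complex.ofReal_re, mul_comm]
  have hE : ip (congDiag W l) (congDiag W l)
      = ∑ i, ∑ j, l i * l j * Complex.normSq (G i j) := by
    rw [ip_congDiag]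
    refine Finset.sum_congr rfl fun i _ => ?_
    rw [hentry, Finset.mul_sum]
    exact Finset.sum_congr rfl fun j _ => by ring
  have hE' : ∑ i, ∑ j, (l i ^ 2 / 2 + l j ^ 2 / 2) * Complex.normSq (G i j)
      = ∑ i, l i ^ 2 * ∑ j, Complex.normSq (G i j) := by
    have h1 : ∑ i, ∑ j, l j ^ 2 / 2 * Complex.normSq (G i j)
        = ∑ i, ∑ j, l i ^ 2 / 2 * Complex.normSq (G i j) := by
      rw [Finset.sum_comm]
      simp only [hsymm]
    simp only [add_mul, Finset.sum_add_distrib, h1, Finset.mul_sum]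
    rw [← Finset.sum_add_distrib]
    refine Finset.sum_congr rfl fun i _ => ?_
    rw [← Finset.sum_add_distrib]
    exact Finset.sum_congr rfl fun j _ => by ring
  rw [hE]
  calc _ ≤ ∑ i, ∑ j, (l i ^ 2 / 2 + l j ^ 2 / 2) * Complex.normSq (G i j) :=
        Finset.sum_le_sum fun i _ => Finset.sum_le_sum fun j _ =>
          mul_le_mul_of_nonneg_right (by nlinarith [sq_nonneg (l i - l j)])
            (Complex.normSq_nonneg _)
    _ = ∑ i, l i ^ 2 * ∑ j, Complex.normSq (G i j) := hE'
    _ ≤ ∑ i, l i ^ 2 * 1 := Finset.sum_le_sum fun i _ =>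
          mul_le_mul_of_nonneg_left (hrow i) (sq_nonneg _)
    _ = _ := by simp

/-- The barrier alone is minimized by the maximally mixed state only. -/
lemma eq_mixedState_of_isMinimizer (hd : 0 < d) {c : ℝ} (hc : 0 < c) {X : Mat d}
    (hX : IsMinimizer (fun Y => c * logDetBarrier Y) X) : X = mixedState d := by
  have hd' : (0 : ℝ) < d := by exact_mod_cast hd
  have hM := mixedState_mem hd
  have h1 := logDetBarrier_bregman hM.1 hX.1.1
  have h2 : ip (mixedState d)⁻¹ (X - mixedState d) = 0 := by
    rw [mixedState, inv_smul_one (by positivity), ip_smul_left, ip_comm, ip_one_right,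
      Matrix.trace_sub, hX.1.2]
    have := hM.2
    rw [mixedState] at this
    rw [this]
    simp
  have h3 : logDetBarrier X ≤ logDetBarrier (mixedState d) :=
    le_of_mul_le_mul_left (hX.2 _ hM) hc
  have h0 := localNorm_nonneg (mixedState d) (X - mixedState d)
  set e := localNorm (mixedState d) (X - mixedState d) with he
  have h4 : e ^ 2 / (2 * (1 + e)) ≤ 0 := by linarith
  have h5 : e = 0 := by
    by_contra hne
    have : 0 < e := lt_of_le_of_ne h0 (Ne.symm hne)
    have : 0 < e ^ 2 / (2 * (1 + e)) := by positivity
    linarith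
  exact sub_eq_zero.1 (eq_zero_of_localNorm_eq_zero hM.1 (hX.1.1.1.sub hM.1.1) h5)

/-! ### Sums of surrogate losses -/

/-- The sum of the surrogate losses around the points `Xs i` minus the linear bias terms
`⟨Y, D i⟩`. -/
noncomputable def surrogateSum (β : ℝ) (Xs Rs D : ℕ → Mat d) (n : ℕ) (Y : Mat d) : ℝ :=
  ∑ i ∈ Finset.range n, (surrogate β (Xs i) (Rs i) Y - ip Y (D i))

lemma continuous_ip_left (G : Mat d) : Continuous fun Y : Mat d => ip Y G := by
  unfold ip
  exact Complex.continuous_re.comp (by fun_prop)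

lemma continuous_surrogateSum (β : ℝ) (Xs Rs D : ℕ → Mat d) (n : ℕ) :
    Continuous (surrogateSum β Xs Rs D n) := by
  unfold surrogateSum surrogate
  have := fun G : Mat d => continuous_ip_left G
  have h2 : ∀ X G : Mat d, Continuous fun Y : Mat d => ip (Y - X) G := fun X G =>
    (this G).comp (by fun_prop)
  refine continuous_finsetSum _ fun i _ => ?_
  refine Continuous.sub ?_ (this _)
  exact (continuous_const.add (h2 _ _)).add (continuous_const.mul ((h2 _ _).pow 2))

lemma surrogate_add_smul (β : ℝ) (X₀ R X K : Mat d) (h : ℝ) :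
    surrogate β X₀ R (X + h • K) = surrogate β X₀ R X
      + h * (ip K (gradLogLoss X₀ R) * (1 + β * ip (X - X₀) (gradLogLoss X₀ R)))
      + h ^ 2 * (β / 2 * ip K (gradLogLoss X₀ R) ^ 2) := by
  rw [surrogate, surrogate, add_sub_right_comm, ip_add_smul_left]
  ring

lemma surrogateSum_add_smul (β : ℝ) (Xs Rs D : ℕ → Mat d) (n : ℕ) (X K : Mat d) (h : ℝ) :
    surrogateSum β Xs Rs D n (X + h • K) = surrogateSum β Xs Rs D n X
      + h * ∑ i ∈ Finset.range n, (ip K (gradLogLoss (Xs i) (Rs i)) *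
          (1 + β * ip (X - Xs i) (gradLogLoss (Xs i) (Rs i))) - ip K (D i))
      + h ^ 2 * ∑ i ∈ Finset.range n, (β / 2 * ip K (gradLogLoss (Xs i) (Rs i)) ^ 2) := by
  unfold surrogateSum
  rw [Finset.mul_sum, Finset.mul_sum, ← Finset.sum_add_distrib, ← Finset.sum_add_distrib]
  refine Finset.sum_congr rfl fun i _ => ?_
  rw [surrogate_add_smul, ip_add_smul_left]
  ring

lemma ip_gradLogLoss (K X R : Mat d) : ip K (gradLogLoss X R) = -(ip K R / ip X R) := by
  rw [gradLogLoss, ip_smul_right]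
  ring

lemma gradLogLoss_isHermitian {R : Mat d} (hR : R.IsHermitian) (X : Mat d) :
    (gradLogLoss X R).IsHermitian :=
  IsHermitian.smul hR (IsSelfAdjoint.all _)

lemma surrogate_self (β : ℝ) (X R : Mat d) : surrogate β X R X = logLoss X R := by
  simp [surrogate, ip]

/-- The objective `η⁻¹ R + ∑ᵢ (f̂ᵢ - ⟨·, Dᵢ⟩)` of follow-the-regularized-leader. -/
noncomputable def ftrlObjective (η β : ℝ) (Xs Rs D : ℕ → Mat d) (n : ℕ) (Y : Mat d) : ℝ :=
  η⁻¹ * logDetBarrier Y + surrogateSum β Xs Rs D n Y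

lemma exists_isMinimizer_ftrlObjective (hd : 0 < d) {η : ℝ} (hη : 0 < η) (β : ℝ)
    (Xs Rs D : ℕ → Mat d) (n : ℕ) : ∃ X, IsMinimizer (ftrlObjective η β Xs Rs D n) X :=
  exists_isMinimizer hd (inv_pos.2 hη) (continuous_surrogateSum β Xs Rs D n)

lemma ftrlObjective_succ (η β : ℝ) (Xs Rs D : ℕ → Mat d) (n : ℕ) (Y : Mat d) :
    ftrlObjective η β Xs Rs D (n + 1) Y = ftrlObjective η β Xs Rs D n Y
      + (surrogate β (Xs n) (Rs n) Y - ip Y (D n)) := by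
  rw [ftrlObjective, ftrlObjective, surrogateSum, surrogateSum, Finset.sum_range_succ]
  ring

/-- The curvature of the objective around its minimizer. -/
lemma ftrl_growth {η β : ℝ} (hη : 0 < η) {Xs Rs D : ℕ → Mat d} {n : ℕ} {X Y : Mat d}
    (hX : IsMinimizer (ftrlObjective η β Xs Rs D n) X) (hY : Y ∈ pdDensityMatrices d) :
    η⁻¹ * (localNorm X (Y - X) ^ 2 / (2 * (1 + localNorm X (Y - X))))
      + ∑ i ∈ Finset.range n, (β / 2 * ip (Y - X) (gradLogLoss (Xs i) (Rs i)) ^ 2)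
      ≤ ftrlObjective η β Xs Rs D n Y - ftrlObjective η β Xs Rs D n X :=
  hX.growth (inv_pos.2 hη).le hY (surrogateSum_add_smul β Xs Rs D n X (Y - X))

lemma ftrl_first_order {η β : ℝ} {Xs Rs D : ℕ → Mat d} {n : ℕ} {X Y : Mat d}
    (hX : IsMinimizer (ftrlObjective η β Xs Rs D n) X) (hY : Y ∈ densityMatrices d) :
    η⁻¹ * ip X⁻¹ (Y - X) ≤ ∑ i ∈ Finset.range n, (ip (Y - X) (gradLogLoss (Xs i) (Rs i)) *
      (1 + β * ip (X - Xs i) (gradLogLoss (Xs i) (Rs i))) - ip (Y - X) (D i)) :=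
  hX.first_order hY (surrogateSum_add_smul β Xs Rs D n X (Y - X))

/-- One step of follow-the-regularized-leader: how far the minimizer moves is controlled by the
loss that is added. -/
lemma ftrl_step {η β : ℝ} (hη : 0 < η) {Xs Rs D : ℕ → Mat d} {n : ℕ} {X Y : Mat d}
    (hX : IsMinimizer (ftrlObjective η β Xs Rs D n) X) (hY : Y ∈ pdDensityMatrices d) :
    ftrlObjective η β Xs Rs D (n + 1) X - ftrlObjective η β Xs Rs D (n + 1) Y
      ≤ -(ip (Y - X) (gradLogLoss (Xs n) (Rs n)) *
            (1 + β * ip (X - Xs n) (gradLogLoss (Xs n) (Rs n)))) + ip (Y - X) (D n)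
        - η⁻¹ * (localNorm X (Y - X) ^ 2 / (2 * (1 + localNorm X (Y - X))))
        - β / 2 * ∑ i ∈ Finset.range (n + 1), ip (Y - X) (gradLogLoss (Xs i) (Rs i)) ^ 2 := by
  have h1 := ftrl_growth hη hX hY
  have h2 := surrogate_add_smul β (Xs n) (Rs n) X (Y - X) 1
  rw [one_smul, add_sub_cancel] at h2
  rw [ftrlObjective_succ, ftrlObjective_succ, Finset.sum_range_succ, h2]
  rw [← Finset.mul_sum] at h1
  have h3 : ip (Y - X) (D n) = ip Y (D n) - ip X (D n) := ip_sub_left _ _ _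
  linarith

/-- The regret decomposition of follow-the-regularized-leader into the price of the regularizer and
the stability terms. -/
lemma ftrl_regret {η β : ℝ} {Xs Rs D : ℕ → Mat d} {n : ℕ}
    {Y : Mat d} (hX : IsMinimizer (ftrlObjective η β Xs Rs D n) (Xs n))
    (hY : Y ∈ pdDensityMatrices d) :
    ∑ i ∈ Finset.range n, ((surrogate β (Xs i) (Rs i) (Xs i) - ip (Xs i) (D i))
        - (surrogate β (Xs i) (Rs i) Y - ip Y (D i)))
      ≤ η⁻¹ * (logDetBarrier Y - logDetBarrier (Xs 0))
        + ∑ i ∈ Finset.range n, (ftrlObjective η β Xs Rs D (i + 1) (Xs i)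
            - ftrlObjective η β Xs Rs D (i + 1) (Xs (i + 1))) := by
  have h1 : ∑ i ∈ Finset.range n, (surrogate β (Xs i) (Rs i) (Xs i) - ip (Xs i) (D i))
      = ∑ i ∈ Finset.range n, (ftrlObjective η β Xs Rs D (i + 1) (Xs i)
            - ftrlObjective η β Xs Rs D (i + 1) (Xs (i + 1)))
        + (ftrlObjective η β Xs Rs D n (Xs n) - ftrlObjective η β Xs Rs D 0 (Xs 0)) := by
    rw [← Finset.sum_range_sub (fun i => ftrlObjective η β Xs Rs D i (Xs i)),
      ← Finset.sum_add_distrib]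
    refine Finset.sum_congr rfl fun i _ => ?_
    rw [ftrlObjective_succ η β Xs Rs D i (Xs i)]
    ring
  have h2 := hX.2 Y hY
  rw [Finset.sum_sub_distrib, h1]
  have h3 : ftrlObjective η β Xs Rs D 0 (Xs 0) = η⁻¹ * logDetBarrier (Xs 0) := by
    simp [ftrlObjective, surrogateSum]
  have h4 : ftrlObjective η β Xs Rs D n Y = η⁻¹ * logDetBarrier Y
      + ∑ i ∈ Finset.range n, (surrogate β (Xs i) (Rs i) Y - ip Y (D i)) := rfl
  rw [h3]
  rw [h4] at h2
  linarith

variable {T : ℕ} {B η β : ℝ} {ρ : ℕ → Mat d} {e n : ℕ}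

/-! ### The parameters -/

/-- The choice of parameters for a game of `T` rounds in dimension `d`. -/
structure Tuning (d T : ℕ) (B η β : ℝ) : Prop where
  one_le_d : 1 ≤ d
  d_sq_le : 110 * d ^ 2 ≤ T
  B_eq : B = 264 / 5 * (d : ℝ) ^ 2 * Real.log T
  η_eq : η = 1 / (4 * B)
  β_eq : β = 11 * (d : ℝ) / (7 * B)

namespace Tuning

lemma d_pos (h : Tuning d T B η β) : 0 < d := h.one_le_d

lemma one_le_d' (h : Tuning d T B η β) : (1 : ℝ) ≤ d := by exact_mod_cast h.one_le_d

lemma d_sq_le' (h : Tuning d T B η β) : 110 * (d : ℝ) ^ 2 ≤ T := by exact_mod_cast h.d_sq_le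

lemma le_T (h : Tuning d T B η β) : (110 : ℝ) ≤ T := by nlinarith [h.one_le_d', h.d_sq_le']

lemma four_le_log (h : Tuning d T B η β) : 4 ≤ Real.log T := by
  rw [Real.le_log_iff_exp_le (by linarith [h.le_T])]
  have h1 : Real.exp 4 = Real.exp 1 ^ 4 := by rw [← Real.exp_nat_mul]; norm_num
  have h2 := Real.exp_one_lt_d9
  rw [h1]
  calc Real.exp 1 ^ 4 ≤ (3 : ℝ) ^ 4 := by
        gcongr
        linarith
    _ ≤ (T : ℝ) := by linarith [h.le_T]

lemma le_B_mul (h : Tuning d T B η β) : 211 * (d : ℝ) ≤ B := by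
  have h1 := h.four_le_log
  have h2 := h.one_le_d'
  rw [h.B_eq]
  have h3 : (d : ℝ) ≤ (d : ℝ) ^ 2 := by nlinarith
  nlinarith

lemma le_B (h : Tuning d T B η β) : 211 ≤ B := by linarith [h.le_B_mul, h.one_le_d']

lemma B_pos (h : Tuning d T B η β) : 0 < B := by linarith [h.le_B]

lemma η_pos (h : Tuning d T B η β) : 0 < η := by
  have := h.B_pos
  rw [h.η_eq]; positivity

lemma η_inv (h : Tuning d T B η β) : η⁻¹ = 4 * B := by rw [h.η_eq, one_div, inv_inv]

lemma η_mul_B (h : Tuning d T B η β) : η * B = 1 / 4 := by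
  have := h.B_pos
  rw [h.η_eq]; field_simp

lemma η_le (h : Tuning d T B η β) : η ≤ 1 / 800 := by
  have := h.B_pos
  have := h.le_B
  rw [h.η_eq]
  exact one_div_le_one_div_of_le (by norm_num) (by linarith)

lemma β_pos (h : Tuning d T B η β) : 0 < β := by
  have := h.B_pos
  have := h.one_le_d'
  rw [h.β_eq]; positivity

lemma β_mul_B (h : Tuning d T B η β) : β * B = 11 * d / 7 := by
  have := h.B_pos
  rw [h.β_eq]; field_simp

lemma β_le (h : Tuning d T B η β) : β ≤ 1 / 100 := by
  have h1 := h.B_pos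
  have h2 := h.β_mul_B
  have h3 := h.le_B_mul
  have h4 := h.one_le_d'
  by_contra hlt
  rw [not_le] at hlt
  nlinarith

end Tuning

/-! ### One epoch -/

/-- The state at internal time `n + 1` of epoch number `e` when the loss matrices of the epoch are
`ρ 0, ρ 1, …` and resets are ignored. -/
noncomputable def epochState (B η β : ℝ) (ρ : ℕ → Mat d) (e : ℕ) : ℕ → State d
  | 0 => State.start d η e
  | n + 1 => (epochState B η β ρ e n).advance B β (ρ n)

/-- The points played in an epoch. -/
noncomputable def epochX (B η β : ℝ) (ρ : ℕ → Mat d) (e : ℕ) (n : ℕ) : Mat d :=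
  (epochState B η β ρ e n).X

/-- The increment `P_(n+1) - P_n` of the bias matrix. -/
noncomputable def epochΔ (B η β : ℝ) (ρ : ℕ → Mat d) (e : ℕ) (n : ℕ) : Mat d :=
  (epochState B η β ρ e n).P - (epochState B η β ρ e n).Pprev

/-- The linear bias `B (P_(n+1) - P_n)` of the loss of internal time `n`. -/
noncomputable def epochD (B η β : ℝ) (ρ : ℕ → Mat d) (e : ℕ) (n : ℕ) : Mat d :=
  B • epochΔ B η β ρ e n

lemma epochState_G (n : ℕ) : (epochState B η β ρ e n).G
    = ftrlObjective η β (epochX B η β ρ e) ρ (epochD B η β ρ e) n := by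
  induction n with
  | zero => ext Y; simp [epochState, State.start, ftrlObjective, surrogateSum]
  | succ n ih =>
    ext Y
    rw [ftrlObjective_succ, ← ih]
    simp only [epochState, State.advance, epochX, epochD, epochΔ, ip_smul_right]
    ring

lemma epochState_Fhat (n : ℕ) : (epochState B η β ρ e n).Fhat
    = ftrlObjective η β (epochX B η β ρ e) ρ 0 n := by
  induction n with
  | zero => ext Y; simp [epochState, State.start, ftrlObjective, surrogateSum]
  | succ n ih =>
    ext Y
    rw [ftrlObjective_succ, ← ih]
    simp [epochState, State.advance, epochX, ip_zero_right]

lemma epochState_X (hd : 0 < d) (hη : 0 < η) (n : ℕ) :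
    IsMinimizer (ftrlObjective η β (epochX B η β ρ e) ρ (epochD B η β ρ e) n)
      (epochX B η β ρ e n) := by
  have h1 : epochX B η β ρ e n = argminDensity (epochState B η β ρ e n).G := by
    cases n <;> rfl
  rw [← epochState_G, h1]
  refine isMinimizer_argminDensity ?_
  rw [epochState_G]
  exact exists_isMinimizer_ftrlObjective hd hη _ _ _ _ _

lemma epochState_U (hd : 0 < d) (hη : 0 < η) (n : ℕ) :
    IsMinimizer (ftrlObjective η β (epochX B η β ρ e) ρ 0 n) (epochState B η β ρ e n).U := by
  have h1 : (epochState B η β ρ e n).U = argminDensity (epochState B η β ρ e n).Fhat := by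
    cases n <;> rfl
  rw [h1, ← epochState_Fhat]
  refine isMinimizer_argminDensity ?_
  rw [epochState_Fhat]
  exact exists_isMinimizer_ftrlObjective hd hη _ _ _ _ _

lemma epochState_P (n : ℕ) : (epochState B η β ρ e n).P
    = biasUpdate (epochState B η β ρ e n).Pprev (epochX B η β ρ e n) := by
  cases n <;> rfl

lemma epochState_Pprev_succ (n : ℕ) :
    (epochState B η β ρ e (n + 1)).Pprev = (epochState B η β ρ e n).P := rfl

lemma isMinimizer_ftrlObjective_zero {Xs Rs D : ℕ → Mat d} {X : Mat d} (hd : 0 < d) (hη : 0 < η)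
    (h : IsMinimizer (ftrlObjective η β Xs Rs D 0) X) : X = mixedState d := by
  refine eq_mixedState_of_isMinimizer hd (inv_pos.2 hη) (c := η⁻¹) ?_
  convert h using 1
  ext Y
  simp [ftrlObjective, surrogateSum]

lemma epochX_zero (hd : 0 < d) (hη : 0 < η) : epochX B η β ρ e 0 = mixedState d :=
  isMinimizer_ftrlObjective_zero hd hη (epochState_X hd hη 0)

lemma epochState_U_zero (hd : 0 < d) (hη : 0 < η) :
    (epochState B η β ρ e 0).U = mixedState d :=
  isMinimizer_ftrlObjective_zero hd hη (epochState_U hd hη 0)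

lemma mixedState_inv (hd : 0 < d) : (mixedState d)⁻¹ = (d : ℝ) • 1 := by
  have hd' : (0 : ℝ) < d := by exact_mod_cast hd
  rw [mixedState, inv_smul_one (by positivity), inv_inv]

lemma epochX_posDef (hd : 0 < d) (hη : 0 < η) (n : ℕ) : (epochX B η β ρ e n).PosDef :=
  (epochState_X hd hη n).1.1

lemma epochState_Pprev_posDef (hd : 0 < d) (hη : 0 < η) (n : ℕ) :
    (epochState B η β ρ e n).Pprev.PosDef := by
  induction n with
  | zero => exact posDef_smul PosDef.one (by exact_mod_cast hd)
  | succ n ih =>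
    rw [epochState_Pprev_succ, epochState_P]
    exact biasUpdate_posDef ih (epochX_posDef hd hη n)

lemma epochState_P_posDef (hd : 0 < d) (hη : 0 < η) (n : ℕ) :
    (epochState B η β ρ e n).P.PosDef :=
  epochState_Pprev_posDef hd hη (n + 1)

/-- `P_n` dominates the inverses of all points played before. -/
lemma epochState_Pprev_sub_inv (hd : 0 < d) (hη : 0 < η) {i n : ℕ} (hi : i < n) :
    ((epochState B η β ρ e n).Pprev - (epochX B η β ρ e i)⁻¹).PosSemidef := by
  induction n with
  | zero => omega
  | succ n ih =>
    rw [epochState_Pprev_succ, epochState_P]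
    have hP := epochState_Pprev_posDef (B := B) (β := β) (ρ := ρ) (e := e) hd hη n
    have hX := epochX_posDef (B := B) (β := β) (ρ := ρ) (e := e) hd hη n
    rcases Nat.lt_succ_iff_lt_or_eq.1 hi with h | rfl
    · have := (biasUpdate_sub_posSemidef hP hX).add (ih h)
      rwa [sub_add_sub_cancel] at this
    · exact biasUpdate_sub_inv_posSemidef hP hX

lemma epochState_Pprev_sub_start (hd : 0 < d) (hη : 0 < η) (n : ℕ) :
    ((epochState B η β ρ e n).Pprev - (d : ℝ) • 1).PosSemidef := by
  rcases n with - | n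
  · simp [epochState, State.start, PosSemidef.zero]
  · have := epochState_Pprev_sub_inv (B := B) (β := β) (ρ := ρ) (e := e) hd hη (Nat.succ_pos n)
    rwa [epochX_zero hd hη, mixedState_inv hd] at this

lemma epochΔ_posSemidef (hd : 0 < d) (hη : 0 < η) (n : ℕ) :
    (epochΔ B η β ρ e n).PosSemidef := by
  rw [epochΔ, epochState_P]
  exact biasUpdate_sub_posSemidef (epochState_Pprev_posDef hd hη n) (epochX_posDef hd hη n)

/-- If the objective with curvature `η⁻¹` is tilted by a loss of dual norm `1 + B N`, then its
minimizer moves by at most `6 η` as long as `N ≤ 6 η`. -/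
lemma move_le {x N : ℝ} (hx : 0 ≤ x) (hη : 0 < η) (hη' : η ≤ 1 / 30) (hBη : η * B = 1 / 4)
    (hN : N ≤ 6 * η)
    (h : η⁻¹ * (x ^ 2 / (2 * (1 + x))) ≤ x * (1 + B * N)) : x ≤ 6 * η := by
  rcases hx.eq_or_lt with rfl | hx
  · positivity
  · rw [inv_mul_le_iff₀ hη, div_le_iff₀ (by positivity)] at h
    have h1 : x * x ≤ x * ((2 * η + N / 2) * (1 + x)) := by
      have : η * (x * (1 + B * N)) * (2 * (1 + x))
          = x * ((2 * η + 2 * (η * B) * N) * (1 + x)) := by ring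
      rw [this, hBη] at h
      nlinarith
    have h2 := le_of_mul_le_mul_left h1 hx
    have h3 : x ≤ 5 * η * (1 + x) := by nlinarith
    by_contra hlt
    rw [not_le] at hlt
    nlinarith

/-- The played points move slowly in the local norm, and so do the bias matrices: the step from
`X_n` to `X_(n+1)` is caused by one loss of local norm one and by a bias increment that is itself
at most as large as the previous step. -/
lemma epoch_stability (h : Tuning d T B η β) (hρ : ∀ i < n, (ρ i).PosSemidef ∧ ρ i ≠ 0) :
    localNorm (epochX B η β ρ e n)⁻¹ (epochΔ B η β ρ e n) ≤ 6 * η ∧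
    ∀ i < n, localNorm (epochX B η β ρ e i)⁻¹ (epochΔ B η β ρ e i) ≤ 6 * η ∧
      localNorm (epochX B η β ρ e i) (epochX B η β ρ e (i + 1) - epochX B η β ρ e i) ≤ 6 * η := by
  have hd := h.d_pos
  have hη := h.η_pos
  have hXp := epochX_posDef (B := B) (β := β) (ρ := ρ) (e := e) hd hη
  induction n with
  | zero =>
    refine ⟨?_, fun i hi => absurd hi (Nat.not_lt_zero i)⟩
    rw [epochΔ, epochState_P]
    refine (localNorm_biasUpdate_sub_le (epochState_Pprev_posDef hd hη 0) (hXp 0) (hXp 0)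
      ?_).trans ?_
    · rw [epochX_zero hd hη, mixedState_inv hd]
      exact epochState_Pprev_sub_start hd hη 0
    · rw [sub_self]
      simp only [localNorm, ip_zero_right, Real.sqrt_zero]
      positivity
  | succ n ih =>
    obtain ⟨ihn, ihi⟩ := ih fun i hi => hρ i (by omega)
    have hmove : localNorm (epochX B η β ρ e n)
        (epochX B η β ρ e (n + 1) - epochX B η β ρ e n) ≤ 6 * η := by
      have h1 := ftrl_step hη (epochState_X (B := B) (β := β) (ρ := ρ) (e := e) hd hη n)
        (epochState_X (B := B) (β := β) (ρ := ρ) (e := e) hd hη (n + 1)).1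
      have h2 := (epochState_X (B := B) (β := β) (ρ := ρ) (e := e) hd hη (n + 1)).2 _
        (epochState_X (B := B) (β := β) (ρ := ρ) (e := e) hd hη n).1
      set X := epochX B η β ρ e n with hX
      set K := epochX B η β ρ e (n + 1) - X with hK
      have hKh : K.IsHermitian := (hXp (n + 1)).1.sub (hXp n).1
      obtain ⟨hR, hR0⟩ := hρ n (by omega)
      have hip : 0 < ip X (ρ n) := ip_pos (hXp n) hR hR0
      have h3 : -ip K (gradLogLoss X (ρ n)) ≤ localNorm X K := by
        rw [ip_gradLogLoss, neg_neg, div_le_iff₀ hip]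
        exact (le_abs_self _).trans (abs_ip_le_localNorm_mul (hXp n) hKh hR)
      have h4 : ip K (epochD B η β ρ e n)
          ≤ B * (localNorm X K * localNorm X⁻¹ (epochΔ B η β ρ e n)) := by
        rw [epochD, ip_smul_right]
        exact mul_le_mul_of_nonneg_left ((le_abs_self _).trans
          (abs_ip_le_localNorm_mul_localNorm_inv (hXp n) hKh (epochΔ_posSemidef hd hη n).1))
          h.B_pos.le
      have h5 : 0 ≤ β / 2 * ∑ i ∈ Finset.range (n + 1),
          ip K (gradLogLoss (epochX B η β ρ e i) (ρ i)) ^ 2 :=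
        mul_nonneg (by linarith [h.β_pos]) (Finset.sum_nonneg fun i _ => sq_nonneg _)
      have h6 : ip (X - X) (gradLogLoss X (ρ n)) = 0 := by simp [ip]
      rw [h6] at h1
      refine move_le (localNorm_nonneg _ _) hη (by linarith [h.η_le]) h.η_mul_B ihn ?_
      linarith
    refine ⟨?_, fun i hi => ?_⟩
    · rw [epochΔ, epochState_P]
      exact (localNorm_biasUpdate_sub_le (epochState_Pprev_posDef hd hη (n + 1)) (hXp (n + 1))
        (hXp n) (epochState_Pprev_sub_inv hd hη (Nat.lt_succ_self n))).trans hmove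
    · rcases Nat.lt_succ_iff_lt_or_eq.1 hi with hi | rfl
      · exact ihi i hi
      · exact ⟨ihn, hmove⟩

/-! ### The regret of the surrogate losses -/

lemma ip_gradLogLoss_self_le {X R P : Mat d} (hd : 0 < d) (hX : X.PosDef) (hR : R.PosSemidef)
    (hR0 : R ≠ 0) (hP : (P - X⁻¹).PosSemidef) :
    ip (gradLogLoss X R) (gradLogLoss X R) ≤ P.trace.re ^ 2 := by
  have h0 := ip_pos hX hR hR0
  have h1 := ip_self_le_trace_sq hR
  have h2 := trace_le_trace_inv_mul_ip hd hX hR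
  have h3 := trace_re_mono hP
  have h4 := trace_re_nonneg hR
  have h5 : R.trace.re ≤ P.trace.re * ip X R := h2.trans (mul_le_mul_of_nonneg_right h3 h0.le)
  rw [gradLogLoss, ip_smul_left, ip_smul_right]
  have h6 : -(ip X R)⁻¹ * (-(ip X R)⁻¹ * ip R R) = ip R R / ip X R ^ 2 := by
    field_simp
  rw [h6, div_le_iff₀ (by positivity), ← mul_pow]
  exact h1.trans (pow_le_pow_left₀ h4 h5 2)

/-- The stability term of one round splits into a part paid for by the curvature of the surrogate
losses and a part paid for by the bias. -/
lemma epoch_stability_term_le (h : Tuning d T B η β)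
    (hρ : ∀ i < n, (ρ i).PosSemidef ∧ ρ i ≠ 0) {i : ℕ} (hi : i < n) :
    ftrlObjective η β (epochX B η β ρ e) ρ (epochD B η β ρ e) (i + 1) (epochX B η β ρ e i)
      - ftrlObjective η β (epochX B η β ρ e) ρ (epochD B η β ρ e) (i + 1) (epochX B η β ρ e (i + 1))
      ≤ (-ip (epochX B η β ρ e (i + 1) - epochX B η β ρ e i)
            (gradLogLoss (epochX B η β ρ e i) (ρ i))
          - (2 * B * ip (epochX B η β ρ e (i + 1) - epochX B η β ρ e i)
                (epochX B η β ρ e (i + 1) - epochX B η β ρ e i)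
            + β * ∑ r ∈ Finset.range (i + 1), ip (epochX B η β ρ e (i + 1) - epochX B η β ρ e i)
                (gradLogLoss (epochX B η β ρ e r) (ρ r)) ^ 2) / 2)
        + B * (localNorm (epochX B η β ρ e i)⁻¹ (epochΔ B η β ρ e i) ^ 2 / 2) := by
  have hd := h.d_pos
  have hη := h.η_pos
  have hB := h.B_pos
  have hXm := epochState_X (B := B) (β := β) (ρ := ρ) (e := e) hd hη
  have h1 := ftrl_step hη (hXm i) (hXm (i + 1)).1
  obtain ⟨hN, hx⟩ := (epoch_stability (e := e) h hρ).2 i hi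
  set X := epochX B η β ρ e i with hX
  set K := epochX B η β ρ e (i + 1) - X with hK
  set N := localNorm X⁻¹ (epochΔ B η β ρ e i)
  set x := localNorm X K
  have hx0 : 0 ≤ x := localNorm_nonneg _ _
  have hKh : K.IsHermitian := (hXm (i + 1)).1.1.1.sub (hXm i).1.1.1
  have h4 : ip K (epochD B η β ρ e i) ≤ B * (x * N) := by
    rw [epochD, ip_smul_right]
    exact mul_le_mul_of_nonneg_left ((le_abs_self _).trans
      (abs_ip_le_localNorm_mul_localNorm_inv (hXm i).1.1 hKh (epochΔ_posSemidef hd hη i).1)) hB.le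
  have h5 : ip K K ≤ x ^ 2 := ip_self_le_localNorm_sq (hXm i).1 hKh
  have h6 : ip (X - X) (gradLogLoss X (ρ i)) = 0 := by simp [ip]
  -- of the coefficient `3 / 2`, the bias uses up `1 / 2` and the losses use up `1`
  have h7 : 3 / 2 * x ^ 2 ≤ 4 * (x ^ 2 / (2 * (1 + x))) := by
    have hx1 : 1 + x ≤ 4 / 3 := by linarith [h.η_le]
    rw [mul_div_assoc', le_div_iff₀ (by positivity)]
    nlinarith [sq_nonneg x]
  have h8 : B * (3 / 2 * x ^ 2) ≤ η⁻¹ * (x ^ 2 / (2 * (1 + x))) := by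
    rw [h.η_inv, mul_comm 4 B, mul_assoc]
    exact mul_le_mul_of_nonneg_left h7 hB.le
  have h9 : B * (x * N) ≤ B * (x ^ 2 / 2 + N ^ 2 / 2) :=
    mul_le_mul_of_nonneg_left (by nlinarith [sq_nonneg (x - N)]) hB.le
  have h10 : B * ip K K ≤ B * x ^ 2 := mul_le_mul_of_nonneg_left h5 hB.le
  rw [h6] at h1
  linarith

/-- The surrogate regret: the negative term `-B ⟨Y, P_n⟩` is what the bias buys. -/
lemma surrogate_regret_le (h : Tuning d T B η β)
    (hρ : ∀ i < n, (ρ i).PosSemidef ∧ ρ i ≠ 0) {Y : Mat d} (hY : Y ∈ pdDensityMatrices d) :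
    ∑ i ∈ Finset.range n, (logLoss (epochX B η β ρ e i) (ρ i)
        - surrogate β (epochX B η β ρ e i) (ρ i) Y)
      ≤ 4 * B * (logDetBarrier Y - logDetBarrier (mixedState d))
        + B * (logDetBarrier ((d : ℝ) • (1 : Mat d))
            - logDetBarrier (epochState B η β ρ e n).Pprev)
        + (d : ℝ) ^ 2 / (2 * β) * Real.log (1 + β / (2 * B * d ^ 2) *
            (n * (epochState B η β ρ e n).Pprev.trace.re ^ 2))
        - B * (ip Y (epochState B η β ρ e n).Pprev - d) := by
  have hd := h.d_pos
  have hd' : (0 : ℝ) < d := by exact_mod_cast hd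
  have hη := h.η_pos
  have hB := h.B_pos
  have hβ := h.β_pos
  have hXm := epochState_X (B := B) (β := β) (ρ := ρ) (e := e) hd hη
  have h1 := ftrl_regret (hXm n) hY
  have h2 := Finset.sum_le_sum fun i (hi : i ∈ Finset.range n) =>
    epoch_stability_term_le (e := e) h hρ (Finset.mem_range.1 hi)
  rw [Finset.sum_add_distrib] at h2
  have h3 := sum_linear_sub_quadratic_le hd (c := 2 * B) (by positivity) hβ (n := n)
    (G := fun i => gradLogLoss (epochX B η β ρ e i) (ρ i))
    (H := fun i => epochX B η β ρ e (i + 1) - epochX B η β ρ e i)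
    (fun i hi => gradLogLoss_isHermitian (hρ i hi).1.1 _)
    (fun i _ => (hXm (i + 1)).1.1.1.sub (hXm i).1.1.1)
  have h4 : ∑ i ∈ Finset.range n, ip (gradLogLoss (epochX B η β ρ e i) (ρ i))
      (gradLogLoss (epochX B η β ρ e i) (ρ i))
      ≤ n * (epochState B η β ρ e n).Pprev.trace.re ^ 2 := by
    have := Finset.sum_le_card_nsmul (Finset.range n) (fun i =>
      ip (gradLogLoss (epochX B η β ρ e i) (ρ i)) (gradLogLoss (epochX B η β ρ e i) (ρ i)))
      ((epochState B η β ρ e n).Pprev.trace.re ^ 2) (fun i hi => by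
        have hi := Finset.mem_range.1 hi
        exact ip_gradLogLoss_self_le hd (hXm i).1.1 (hρ i hi).1 (hρ i hi).2
          (epochState_Pprev_sub_inv hd hη hi))
    simpa using this
  have h4' : 0 ≤ ∑ i ∈ Finset.range n, ip (gradLogLoss (epochX B η β ρ e i) (ρ i))
      (gradLogLoss (epochX B η β ρ e i) (ρ i)) := Finset.sum_nonneg fun i hi => by
    rw [ip_self_eq_sum (gradLogLoss_isHermitian (hρ i (Finset.mem_range.1 hi)).1.1 _)]
    exact Finset.sum_nonneg fun i _ => Finset.sum_nonneg fun j _ => Complex.normSq_nonneg _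
  have h5 : (d : ℝ) ^ 2 / (2 * β) * Real.log (1 + β / (2 * B * d ^ 2) *
        ∑ i ∈ Finset.range n, ip (gradLogLoss (epochX B η β ρ e i) (ρ i))
          (gradLogLoss (epochX B η β ρ e i) (ρ i)))
      ≤ (d : ℝ) ^ 2 / (2 * β) * Real.log (1 + β / (2 * B * d ^ 2) *
        (n * (epochState B η β ρ e n).Pprev.trace.re ^ 2)) := by
    gcongr
  -- the bias at the played points is paid for by the growth of `log det P`
  have h6 : ∑ i ∈ Finset.range n, (ip (epochX B η β ρ e i) (epochD B η β ρ e i)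
        + B * (localNorm (epochX B η β ρ e i)⁻¹ (epochΔ B η β ρ e i) ^ 2 / 2))
      ≤ B * (logDetBarrier ((d : ℝ) • (1 : Mat d))
          - logDetBarrier (epochState B η β ρ e n).Pprev) := by
    have : ∀ i ∈ Finset.range n, ip (epochX B η β ρ e i) (epochD B η β ρ e i)
        + B * (localNorm (epochX B η β ρ e i)⁻¹ (epochΔ B η β ρ e i) ^ 2 / 2)
        ≤ B * (logDetBarrier (epochState B η β ρ e i).Pprev
          - logDetBarrier (epochState B η β ρ e (i + 1)).Pprev) := fun i _ => by
      have := ip_biasUpdate_sub_le (epochState_Pprev_posDef (B := B) (β := β) (ρ := ρ) (e := e)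
        hd hη i) (hXm i).1.1
      rw [epochD, ip_smul_right, ← mul_add, epochState_Pprev_succ, epochΔ, epochState_P]
      exact mul_le_mul_of_nonneg_left this hB.le
    refine (Finset.sum_le_sum this).trans ?_
    rw [← Finset.mul_sum,
      Finset.sum_range_sub' (fun i => logDetBarrier (epochState B η β ρ e i).Pprev)]
    rfl
  have h7 : ∑ i ∈ Finset.range n, ip Y (epochD B η β ρ e i)
      = B * (ip Y (epochState B η β ρ e n).Pprev - d) := by
    have hs : ∀ i, ip Y (epochD B η β ρ e i) = B * (ip Y (epochState B η β ρ e (i + 1)).Pprev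
        - ip Y (epochState B η β ρ e i).Pprev) := fun i => by
      rw [epochD, ip_smul_right, epochΔ, ip_sub_right]
      rfl
    simp only [hs]
    rw [← Finset.mul_sum,
      Finset.sum_range_sub (fun i => ip Y (epochState B η β ρ e i).Pprev)]
    have : ip Y (epochState B η β ρ e 0).Pprev = d := by
      change ip Y ((d : ℝ) • 1) = d
      rw [ip_smul_right, ip_one_of_density (pdDensity_subset hY), mul_one]
    rw [this]
  have h8 : ∑ i ∈ Finset.range n, (logLoss (epochX B η β ρ e i) (ρ i)
        - surrogate β (epochX B η β ρ e i) (ρ i) Y)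
      = ∑ i ∈ Finset.range n, ((surrogate β (epochX B η β ρ e i) (ρ i) (epochX B η β ρ e i)
          - ip (epochX B η β ρ e i) (epochD B η β ρ e i))
        - (surrogate β (epochX B η β ρ e i) (ρ i) Y - ip Y (epochD B η β ρ e i)))
        + ∑ i ∈ Finset.range n, ip (epochX B η β ρ e i) (epochD B η β ρ e i)
        - ∑ i ∈ Finset.range n, ip Y (epochD B η β ρ e i) := by
    rw [← Finset.sum_add_distrib, ← Finset.sum_sub_distrib]
    refine Finset.sum_congr rfl fun i _ => ?_
    rw [surrogate_self]
    ring
  rw [Finset.sum_add_distrib] at h6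
  rw [h.η_inv, epochX_zero hd hη] at h1
  rw [h8, ← h7]
  linarith

/-! ### From surrogate losses to log losses -/

/-- For `β a ≤ 3/4`, the convex function `-log (1 + z)` lies above the tangent at `a` of the
parabola `-a + β a² / 2`. -/
lemma tangent_le_neg_log {a z : ℝ} (hβ : 0 < β) (hβ' : β ≤ 1 / 8) (ha : β * a ≤ 3 / 4)
    (hz : -1 < z) : -a + β / 2 * a ^ 2 + (z - a) * (β * a - 1) ≤ -Real.log (1 + z) := by
  set q := 1 - β * a with hq
  have hq0 : 1 / 4 ≤ q := by linarith
  have hqp : 0 < q := by linarith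
  -- `-log` lies above its tangent of slope `-q`
  have h1 : Real.log (1 + z) + Real.log q ≤ q * (1 + z) - 1 := by
    rw [← Real.log_mul (by linarith) hqp.ne', mul_comm]
    exact Real.log_le_sub_one_of_pos (mul_pos hqp (by linarith))
  have h2 : -Real.log q ≤ q⁻¹ - 1 := by
    rw [← Real.log_inv]
    exact Real.log_le_sub_one_of_pos (inv_pos.2 hqp)
  have h3 : q - 1 - Real.log q ≤ 4 * (1 - q) ^ 2 := by
    have h4 : q - 1 + (q⁻¹ - 1) = (1 - q) ^ 2 * q⁻¹ := by
      field_simp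
      ring
    have h5 : q⁻¹ ≤ 4 := by
      rw [inv_le_comm₀ hqp (by norm_num)]
      linarith
    nlinarith [mul_le_mul_of_nonneg_left h5 (sq_nonneg (1 - q))]
  have h6 : 4 * (1 - q) ^ 2 ≤ β * a ^ 2 / 2 := by
    have : (1 - q) ^ 2 = β * (β * a ^ 2) := by rw [hq]; ring
    rw [this]
    nlinarith [mul_nonneg hβ.le (sq_nonneg a)]
  have h7 : (z - a) * (β * a - 1) = -(z - a) * q := by rw [hq]; ring
  have h8 : a * q = a - β * a ^ 2 := by rw [hq]; ring
  rw [h7]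
  nlinarith

lemma surrogate_tangent_le_logLoss {X R U Y : Mat d} (hβ : 0 < β) (hβ' : β ≤ 1 / 8)
    (hX : 0 < ip X R) (hY : 0 < ip Y R) (hU : β * ip U R ≤ 3 / 4 * ip X R) :
    surrogate β X R U + ip (Y - U) (gradLogLoss X R) * (1 + β * ip (U - X) (gradLogLoss X R))
      ≤ logLoss Y R := by
  set a := ip U R / ip X R - 1 with ha
  set z := ip Y R / ip X R - 1 with hz
  have h1 : ip (U - X) (gradLogLoss X R) = -a := by
    rw [ip_gradLogLoss, ip_sub_left, ha, sub_div, div_self hX.ne']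
  have h2 : ip (Y - U) (gradLogLoss X R) = -(z - a) := by
    rw [ip_gradLogLoss, ip_sub_left, ha, hz, sub_div]
    ring
  have h3 : logLoss Y R = logLoss X R - Real.log (1 + z) := by
    rw [logLoss, logLoss, hz, add_sub_cancel, Real.log_div hY.ne' hX.ne']
    ring
  have hz1 : -1 < z := by
    have := div_pos hY hX
    linarith
  have ha1 : β * a ≤ 3 / 4 := by
    have : β * (ip U R / ip X R) ≤ 3 / 4 := by
      rw [mul_div_assoc', div_le_iff₀ hX]
      exact hU
    rw [ha, mul_sub]
    linarith
  have := tangent_le_neg_log hβ hβ' ha1 hz1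
  rw [surrogate, h1, h2, h3]
  nlinarith

/-- If the reference solution `U` stays in the region where the surrogates are tight enough, then
its regularized surrogate loss is a lower bound for the regularized log loss of every comparator. -/
lemma ftrlObjective_le_logLoss {Xs Rs : ℕ → Mat d} {U Y : Mat d} (hη : 0 < η) (hβ : 0 < β)
    (hβ' : β ≤ 1 / 8) (hU : IsMinimizer (ftrlObjective η β Xs Rs 0 n) U)
    (hY : Y ∈ pdDensityMatrices d) (hX : ∀ i < n, 0 < ip (Xs i) (Rs i))
    (hYR : ∀ i < n, 0 < ip Y (Rs i))
    (hUX : ∀ i < n, β * ip U (Rs i) ≤ 3 / 4 * ip (Xs i) (Rs i)) :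
    ftrlObjective η β Xs Rs 0 n U
      ≤ η⁻¹ * logDetBarrier Y + ∑ i ∈ Finset.range n, logLoss Y (Rs i) := by
  have h1 := ftrl_first_order hU (pdDensity_subset hY)
  have h2 := mul_le_mul_of_nonneg_left (logDetBarrier_gradient_le hU.1.1 hY.1) (inv_pos.2 hη).le
  have h3 := Finset.sum_le_sum fun i (hi : i ∈ Finset.range n) =>
    have hi := Finset.mem_range.1 hi
    surrogate_tangent_le_logLoss hβ hβ' (hX i hi) (hYR i hi) (hUX i hi)
  rw [Finset.sum_add_distrib] at h3
  simp only [Pi.zero_apply, ip_zero_right, sub_zero] at h1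
  have h4 : ftrlObjective η β Xs Rs 0 n U = η⁻¹ * logDetBarrier U
      + ∑ i ∈ Finset.range n, surrogate β (Xs i) (Rs i) U := by
    simp [ftrlObjective, surrogateSum, ip_zero_right]
  rw [h4]
  rw [mul_sub] at h2
  linarith

lemma trace_congDiag_of_unitary {V : Mat d} (hV : Vᴴ * V = 1) (l : Fin d → ℝ) :
    (congDiag V l).trace = ∑ i, (l i : ℂ) := by
  rw [congDiag, Matrix.trace_mul_comm, ← Matrix.mul_assoc, hV, Matrix.one_mul,
    Matrix.trace_diagonal]

/-- If `U⁻¹` has inner product at most `c` with every density matrix, then `U ⪰ c⁻¹ I`. -/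
lemma trace_le_mul_ip {U P : Mat d} {c : ℝ} (hc : 0 < c) (hU : U.PosDef)
    (h : ∀ Y ∈ densityMatrices d, ip U⁻¹ Y ≤ c) (hP : P.PosSemidef) :
    P.trace.re ≤ c * ip U P := by
  have h1 : (c • (1 : Mat d) - U⁻¹).PosSemidef := by
    obtain ⟨V, l, hV, h1, hl⟩ := exists_congDiag PosDef.one hU.inv.1
    have hVV : Vᴴ * V = 1 := by
      rw [congDiag_one] at h1
      exact mul_eq_one_comm.1 h1.symm
    rw [hl]
    nth_rewrite 1 [h1]
    rw [← congDiag_smul, ← congDiag_sub]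
    refine posSemidef_congDiag fun i => ?_
    have hY : congDiag V (Pi.single i 1) ∈ densityMatrices d := by
      refine ⟨posSemidef_congDiag fun j => ?_, ?_⟩
      · rcases eq_or_ne j i with rfl | hj
        · simp
        · simp [hj]
      · rw [trace_congDiag_of_unitary hVV, ← Complex.ofReal_sum]
        simp
    have := h _ hY
    rw [hl, ip_congDiag_dual hVV] at this
    simpa [Pi.single_apply] using this
  have h2 := inv_sub_inv_posSemidef hU.inv h1
  rw [inv_inv_of_posDef hU, inv_smul_one hc] at h2
  have h3 := ip_mono_left h2 hP
  rw [ip_smul_left, ip_comm 1, ip_one_right, inv_mul_le_iff₀ hc] at h3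
  exact h3

lemma ip_inv_self {U : Mat d} (hU : U.PosDef) : ip U⁻¹ U = d := by
  rw [ip, nonsing_inv_mul _ ((isUnit_iff_isUnit_det _).1 hU.isUnit)]
  simp

/-- The reference solution satisfies `U ⪰ (16 d / T) I`: its gradient equation bounds `U⁻¹`, since
all losses have negative semidefinite surrogate gradients at `U`. -/
lemma trace_le_mul_ip_of_isMinimizer (h : Tuning d T B η β) {Xs Rs : ℕ → Mat d} {U P : Mat d}
    (hn : n ≤ T) (hU : IsMinimizer (ftrlObjective η β Xs Rs 0 n) U)
    (hX : ∀ i < n, 0 < ip (Xs i) (Rs i)) (hR : ∀ i < n, (Rs i).PosSemidef)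
    (hUX : ∀ i < n, β * ip U (Rs i) ≤ 3 / 4 * ip (Xs i) (Rs i)) (hP : P.PosSemidef) :
    P.trace.re ≤ T / (16 * d) * ip U P := by
  have hd := h.d_pos
  have hd' : (0 : ℝ) < d := by exact_mod_cast hd
  have hη := h.η_pos
  have hβ := h.β_pos
  have hT : (0 : ℝ) < T := by linarith [h.le_T]
  refine trace_le_mul_ip (by positivity) hU.1.1 (fun Y hY => ?_) hP
  have h1 := ftrl_first_order hU hY
  simp only [Pi.zero_apply, ip_zero_right, sub_zero] at h1
  have h2 : ∀ i ∈ Finset.range n, ip (Y - U) (gradLogLoss (Xs i) (Rs i)) *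
      (1 + β * ip (U - Xs i) (gradLogLoss (Xs i) (Rs i))) ≤ (1 + β) ^ 2 / (4 * β) := by
    intro i hi
    have hi := Finset.mem_range.1 hi
    have hXi := hX i hi
    have hy : 0 ≤ ip Y (Rs i) / ip (Xs i) (Rs i) := div_nonneg (ip_nonneg hY.1 (hR i hi)) hXi.le
    set w := ip U (Rs i) / ip (Xs i) (Rs i) with hw
    have hw1 : β * w ≤ 3 / 4 := by
      rw [hw, mul_div_assoc', div_le_iff₀ hXi]
      exact hUX i hi
    rw [ip_gradLogLoss, ip_gradLogLoss, ip_sub_left, ip_sub_left, sub_div, sub_div,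
      div_self hXi.ne', ← hw, le_div_iff₀ (by positivity)]
    -- the term of `Y` is nonpositive, and the term of `U` is the parabola `w (1 + β - β w)`
    have h3 : 0 ≤ 1 + β * -(w - 1) := by linarith
    have h4 := mul_nonneg hy h3
    have h5 := mul_nonneg h4 (by positivity : 0 ≤ 4 * β)
    nlinarith [sq_nonneg (1 + β - 2 * (β * w))]
  have h3 := h1.trans (Finset.sum_le_card_nsmul _ _ _ h2)
  rw [Finset.card_range, nsmul_eq_mul, inv_mul_le_iff₀ hη, ip_sub_right, ip_inv_self hU.1.1] at h3
  have h4 : (n : ℝ) * ((1 + β) ^ 2 / (4 * β)) ≤ T * ((1 + β) ^ 2 / (4 * β)) := by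
    gcongr
  have h5 : η * (T * ((1 + β) ^ 2 / (4 * β))) = 7 / 176 * (1 + β) ^ 2 * (T / d) := by
    have := h.B_pos
    rw [h.η_eq]
    nth_rewrite 2 [h.β_eq]
    field_simp
    norm_num
  have h6 : (1 + β) ^ 2 ≤ 11 / 10 := by nlinarith [h.β_le]
  have h7 : 7 / 176 * (1 + β) ^ 2 * (T / d) ≤ 7 / 160 * ((T : ℝ) / d) := by
    have : (0 : ℝ) ≤ T / d := by positivity
    nlinarith
  have h8 : (d : ℝ) ≤ 1 / 110 * (T / d) := by
    rw [mul_div_assoc', le_div_iff₀ hd']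
    have := h.d_sq_le'
    nlinarith
  have h9 : (T : ℝ) / (16 * d) = 1 / 16 * (T / d) := by field_simp
  have h10 := mul_le_mul_of_nonneg_left h4 hη.le
  have : (0 : ℝ) ≤ T / d := by positivity
  rw [h9]
  linarith

/-! ### The regret of one epoch -/

/-- The reference solution `U` of internal time `n` is so close to the played points that the
surrogate losses are lower bounds for the log losses around it. -/
def InTightRegion (B η β : ℝ) (ρ : ℕ → Mat d) (e n : ℕ) : Prop :=
  ∀ i < n, β * ip (epochState B η β ρ e n).U (ρ i) ≤ 3 / 4 * ip (epochX B η β ρ e i) (ρ i)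

lemma one_le_ip_div (h : Tuning d T B η β) (n : ℕ) :
    1 ≤ ip (epochState B η β ρ e n).U (epochState B η β ρ e n).Pprev / d := by
  have hd' : (0 : ℝ) < d := by exact_mod_cast h.d_pos
  have hU := (epochState_U (B := B) (β := β) (ρ := ρ) (e := e) h.d_pos h.η_pos n).1
  have h1 := ip_mono_left (epochState_Pprev_sub_start (B := B) (β := β) (ρ := ρ) (e := e)
    h.d_pos h.η_pos n) hU.1.posSemidef
  rw [ip_smul_left, ip_comm 1, ip_one_of_density (pdDensity_subset hU), mul_one, ip_comm] at h1
  rwa [one_le_div hd']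

/-- The regret of one epoch in terms of the ratio `a = ⟨U, P⟩ / d`: a logarithmic gain of `a`
against a linear loss. -/
lemma epoch_regret_le (h : Tuning d T B η β) (hρ : ∀ i < n, (ρ i).PosSemidef ∧ ρ i ≠ 0)
    (hn : n ≤ T) (hreg : InTightRegion B η β ρ e n) {Y : Mat d} (hY : Y ∈ pdDensityMatrices d)
    {a : ℝ} (ha : a = ip (epochState B η β ρ e n).U (epochState B η β ρ e n).Pprev / d) :
    ∑ i ∈ Finset.range n, (logLoss (epochX B η β ρ e i) (ρ i) - logLoss Y (ρ i))
      ≤ 4 * B * (logDetBarrier Y - d * Real.log d)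
        + d * B * (43 / 22 * Real.log T + 18 / 11 * Real.log a + 1 - a) := by
  have hd := h.d_pos
  have hd' : (0 : ℝ) < d := by exact_mod_cast hd
  have hd1 := h.one_le_d'
  have hη := h.η_pos
  have hB := h.B_pos
  have hβ := h.β_pos
  have hT : (1 : ℝ) ≤ T := by linarith [h.le_T]
  have ha1 : 1 ≤ a := ha ▸ one_le_ip_div h n
  have hXp : ∀ i < n, 0 < ip (epochX B η β ρ e i) (ρ i) := fun i hi =>
    ip_pos (epochX_posDef hd hη i) (hρ i hi).1 (hρ i hi).2
  have hUm := epochState_U (B := B) (β := β) (ρ := ρ) (e := e) hd hη n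
  have h1 := surrogate_regret_le (e := e) h hρ hUm.1
  have h2 := ftrlObjective_le_logLoss hη hβ (by linarith [h.β_le]) hUm hY hXp
    (fun i hi => ip_pos hY.1 (hρ i hi).1 (hρ i hi).2) hreg
  have hPp := epochState_Pprev_posDef (B := B) (β := β) (ρ := ρ) (e := e) hd hη n
  have h3 := trace_le_mul_ip_of_isMinimizer h hn hUm hXp (fun i hi => (hρ i hi).1) hreg
    hPp.posSemidef
  have h4 := neg_logDetBarrier_le hd hPp
  have hne : Nonempty (Fin d) := ⟨⟨0, hd⟩⟩
  have htr0 : 0 < (epochState B η β ρ e n).Pprev.trace.re := (Complex.lt_def.1 hPp.trace_pos).1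
  set U := (epochState B η β ρ e n).U
  set P := (epochState B η β ρ e n).Pprev
  have hy : ip U P = d * a := by rw [ha]; field_simp
  rw [hy] at h1 h3
  have htr : P.trace.re ≤ T * a := by
    have : (T : ℝ) / (16 * d) * (d * a) = T * a / 16 := by field_simp
    rw [this] at h3
    nlinarith
  have hlogTa : Real.log (T * a) = Real.log T + Real.log a :=
    Real.log_mul (by linarith) (by linarith)
  have h5 : -logDetBarrier P ≤ d * (Real.log T + Real.log a) := by
    refine h4.trans (mul_le_mul_of_nonneg_left ?_ hd'.le)
    rw [← hlogTa]
    refine Real.log_le_log (by positivity) (le_trans ?_ htr)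
    exact div_le_self htr0.le hd1
  have h6 : Real.log (1 + β / (2 * B * d ^ 2) * (n * P.trace.re ^ 2))
      ≤ 3 * Real.log T + 2 * Real.log a := by
    have e1 : 3 * Real.log T + 2 * Real.log a = Real.log ((T : ℝ) ^ 3 * a ^ 2) := by
      rw [Real.log_mul (by positivity) (by positivity), Real.log_pow, Real.log_pow]
      norm_num
    rw [e1]
    refine Real.log_le_log (by positivity) ?_
    have e2 : β / (2 * B * d ^ 2) ≤ 1 / 2 := by
      rw [div_le_div_iff₀ (by positivity) (by norm_num)]
      have := h.β_le
      have := h.le_B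
      have : (1 : ℝ) ≤ (d : ℝ) ^ 2 := one_le_pow₀ hd1
      nlinarith
    have e3 : (n : ℝ) * P.trace.re ^ 2 ≤ T * (T * a) ^ 2 := by
      gcongr
    have e4 : (T : ℝ) * (T * a) ^ 2 = T ^ 3 * a ^ 2 := by ring
    have e5 : (2 : ℝ) ≤ T ^ 3 * a ^ 2 := by
      have t3 : (110 : ℝ) ^ 3 ≤ (T : ℝ) ^ 3 := pow_le_pow_left₀ (by norm_num) h.le_T 3
      have a2 : (1 : ℝ) ≤ a ^ 2 := one_le_pow₀ ha1
      nlinarith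
    have e6 : β / (2 * B * d ^ 2) * (n * P.trace.re ^ 2) ≤ 1 / 2 * (T ^ 3 * a ^ 2) := by
      rw [← e4]
      exact mul_le_mul e2 e3 (by positivity) (by norm_num)
    linarith
  have h7 : (d : ℝ) ^ 2 / (2 * β) = d * B * (7 / 22) := by
    rw [h.β_eq]
    field_simp
    norm_num
  have h8 : logDetBarrier (mixedState d) = d * Real.log d := by
    rw [mixedState, logDetBarrier_smul_one (by positivity), Real.log_inv]
    ring
  have h9 : logDetBarrier ((d : ℝ) • (1 : Mat d)) ≤ 0 := by
    rw [logDetBarrier_smul_one hd']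
    have := Real.log_nonneg hd1
    nlinarith
  have h10 : ftrlObjective η β (epochX B η β ρ e) ρ 0 n U = 4 * B * logDetBarrier U
      + ∑ i ∈ Finset.range n, surrogate β (epochX B η β ρ e i) (ρ i) U := by
    simp [ftrlObjective, surrogateSum, ip_zero_right, h.η_inv]
  rw [h10, h.η_inv] at h2
  rw [h7, h8] at h1
  rw [Finset.sum_sub_distrib] at h1 ⊢
  have h11 := mul_le_mul_of_nonneg_left h6 (by positivity : 0 ≤ d * B * (7 / 22))
  have h12 : B * (logDetBarrier ((d : ℝ) • (1 : Mat d)) - logDetBarrier P)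
      ≤ B * (d * (Real.log T + Real.log a)) :=
    mul_le_mul_of_nonneg_left (by linarith) hB.le
  nlinarith

/-- As long as the reset condition has not been met, `U` is dominated by every played point. -/
lemma ip_U_le (h : Tuning d T B η β)
    (hnr : 1 ≤ n → ¬ (epochState B η β ρ e n).ResetCondition η β) {i : ℕ} (hi : i ≤ n)
    (hR : (ρ i).PosSemidef) :
    β * ip (epochState B η β ρ e n).U (ρ i) ≤ 1 / 2 * ip (epochX B η β ρ e i) (ρ i) := by
  have hd := h.d_pos
  have hη := h.η_pos
  have hβ := h.β_pos
  have hX := ip_nonneg (epochX_posDef (B := B) (β := β) (ρ := ρ) (e := e) hd hη i).posSemidef hR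
  rcases Nat.eq_zero_or_pos n with rfl | hn
  · obtain rfl : i = 0 := by omega
    rw [epochState_U_zero hd hη]
    rw [epochX_zero hd hη] at hX ⊢
    nlinarith [h.β_le]
  · have h1 := hnr hn
    rw [State.ResetCondition, not_not] at h1
    have h2 := ip_le_of_posDef_sub (by positivity) (epochX_posDef hd hη i) h1
      (epochState_Pprev_sub_inv hd hη (Nat.lt_succ_of_le hi)) hR
    have h3 := mul_le_mul_of_nonneg_left h2 hβ.le
    refine h3.trans ?_
    rw [← mul_assoc]
    refine mul_le_mul_of_nonneg_right ?_ hX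
    have h4 : β * (2 * (1 + 6 * η) * β)⁻¹ = (2 * (1 + 6 * η))⁻¹ := by
      field_simp
    rw [h4, one_div]
    exact inv_anti₀ (by norm_num) (by linarith)

lemma inTightRegion_of_not_reset (h : Tuning d T B η β)
    (hρ : ∀ i < n, (ρ i).PosSemidef ∧ ρ i ≠ 0)
    (hnr : 1 ≤ n → ¬ (epochState B η β ρ e n).ResetCondition η β) :
    InTightRegion B η β ρ e n := fun i hi => by
  have h1 := ip_U_le h hnr hi.le (hρ i hi).1
  have h2 := ip_nonneg (epochX_posDef (B := B) (β := β) (ρ := ρ) (e := e) h.d_pos h.η_pos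
    i).posSemidef (hρ i hi).1
  linarith

/-- The reference solution moves slowly as well, so it is still in the region of tight surrogates
when a reset is triggered. -/
lemma inTightRegion_succ (h : Tuning d T B η β) (hρ : ∀ i < n + 1, (ρ i).PosSemidef ∧ ρ i ≠ 0)
    (hnr : 1 ≤ n → ¬ (epochState B η β ρ e n).ResetCondition η β) :
    InTightRegion B η β ρ e (n + 1) := by
  have hd := h.d_pos
  have hη := h.η_pos
  have hβ := h.β_pos
  have hU := epochState_U (B := B) (β := β) (ρ := ρ) (e := e) hd hη n
  have hU' := epochState_U (B := B) (β := β) (ρ := ρ) (e := e) hd hη (n + 1)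
  have hXn := epochX_posDef (B := B) (β := β) (ρ := ρ) (e := e) hd hη n
  have h1 := ftrl_step hη hU hU'.1
  have h2 := hU'.2 _ hU.1
  set U := (epochState B η β ρ e n).U with hUdef
  set K := (epochState B η β ρ e (n + 1)).U - U with hK
  have hKh : K.IsHermitian := hU'.1.1.1.sub hU.1.1.1
  set x := localNorm U K with hx
  have hx0 : 0 ≤ x := localNorm_nonneg _ _
  have hxle : x ≤ 1 / 4 := by
    obtain ⟨hR, hR0⟩ := hρ n (by omega)
    have hXR := ip_pos hXn hR hR0
    have hreg := ip_U_le h hnr le_rfl hR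
    rw [← hUdef] at hreg
    set w := ip U (ρ n) / ip (epochX B η β ρ e n) (ρ n) with hw
    have hw1 : β * w ≤ 1 / 2 := by
      rw [hw, mul_div_assoc', div_le_iff₀ hXR]
      exact hreg
    have hKR : ip K (ρ n) / ip (epochX B η β ρ e n) (ρ n) ≤ x * w := by
      rw [hw, mul_div_assoc']
      exact div_le_div_of_nonneg_right
        ((le_abs_self _).trans (abs_ip_le_localNorm_mul hU.1.1 hKh hR)) hXR.le
    have h3 : 0 ≤ β / 2 * ∑ i ∈ Finset.range (n + 1),
        ip K (gradLogLoss (epochX B η β ρ e i) (ρ i)) ^ 2 :=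
      mul_nonneg (by linarith) (Finset.sum_nonneg fun i _ => sq_nonneg _)
    have h4 : ip (U - epochX B η β ρ e n) (gradLogLoss (epochX B η β ρ e n) (ρ n)) = 1 - w := by
      rw [ip_gradLogLoss, ip_sub_left, sub_div, div_self hXR.ne', hw]
      ring
    rw [h4, ip_gradLogLoss, Pi.zero_apply, ip_zero_right] at h1
    have h5 : ip K (ρ n) / ip (epochX B η β ρ e n) (ρ n) * (1 + β * (1 - w))
        ≤ x * w * (1 + β * (1 - w)) :=
      mul_le_mul_of_nonneg_right hKR (by linarith)
    -- the gradient of the newest surrogate at `U` is at most the maximum of this parabola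
    have h6 : w * (1 + β * (1 - w)) ≤ (1 + β) ^ 2 / (4 * β) := by
      rw [le_div_iff₀ (by positivity)]
      nlinarith [sq_nonneg (1 + β - 2 * (β * w))]
    have h7 : η⁻¹ * (x ^ 2 / (2 * (1 + x))) ≤ x * ((1 + β) ^ 2 / (4 * β)) := by
      have := mul_le_mul_of_nonneg_left h6 hx0
      linarith
    rw [inv_mul_le_iff₀ hη, div_le_iff₀ (by positivity)] at h7
    have h8 : η * ((1 + β) ^ 2 / (4 * β)) ≤ 1 / 20 := by
      have hηβ : η = 7 / (44 * d) * β := by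
        have := h.B_pos
        have : (0 : ℝ) < d := by exact_mod_cast hd
        rw [h.η_eq, h.β_eq]
        field_simp
        norm_num
      have : η * ((1 + β) ^ 2 / (4 * β)) = 7 / 176 * (1 + β) ^ 2 / d := by
        have : (0 : ℝ) < d := by exact_mod_cast hd
        rw [hηβ]
        field_simp
        norm_num
      rw [this, div_le_iff₀ (by exact_mod_cast hd)]
      nlinarith [h.β_le, h.one_le_d']
    by_contra hlt
    rw [not_le] at hlt
    have h9 : x * x ≤ x * (1 / 10 * (1 + x)) := by
      have e1 : η * (x * ((1 + β) ^ 2 / (4 * β))) * (2 * (1 + x))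
          = η * ((1 + β) ^ 2 / (4 * β)) * (x * (2 * (1 + x))) := by ring
      have e2 := mul_le_mul_of_nonneg_right h8 (by positivity : 0 ≤ x * (2 * (1 + x)))
      rw [e1] at h7
      nlinarith
    have := le_of_mul_le_mul_left h9 (by linarith)
    linarith
  intro i hi
  obtain ⟨hR, hR0⟩ := hρ i hi
  have h3 := ip_U_le h hnr (Nat.lt_succ_iff.1 hi) hR
  have h4 := (le_abs_self _).trans (abs_ip_le_localNorm_mul hU.1.1 hKh hR)
  rw [← hUdef] at h3
  have hUR := ip_nonneg hU.1.1.posSemidef hR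
  have h5 : ip (epochState B η β ρ e (n + 1)).U (ρ i) ≤ 5 / 4 * ip U (ρ i) := by
    rw [hK, ip_sub_left] at h4
    nlinarith
  have h6 := ip_nonneg (epochX_posDef (B := B) (β := β) (ρ := ρ) (e := e) hd hη i).posSemidef hR
  nlinarith

/-- When a reset is triggered, `U` has a large inner product with the bias matrix. The reset
condition is about the newest bias matrix `P_(n+1)`, the regret bound about `P_n`; the inner product
with `P_n` is smaller by a factor `1 - 6 η` at worst. -/
lemma le_ip_of_reset (h : Tuning d T B η β) (hρ : ∀ i < n, (ρ i).PosSemidef ∧ ρ i ≠ 0)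
    (hr : (epochState B η β ρ e n).ResetCondition η β) :
    16 * Real.log T ≤ ip (epochState B η β ρ e n).U (epochState B η β ρ e n).Pprev / d := by
  have hd := h.d_pos
  have hd' : (0 : ℝ) < d := by exact_mod_cast hd
  have hη := h.η_pos
  have hB := h.B_pos
  have hL := h.four_le_log
  have hU := (epochState_U (B := B) (β := β) (ρ := ρ) (e := e) hd hη n).1.1.posSemidef
  have hXp := epochX_posDef (B := B) (β := β) (ρ := ρ) (e := e) hd hη n
  have h1 := le_ip_of_not_posDef hU
    (epochState_P_posDef (B := B) (β := β) (ρ := ρ) (e := e) hd hη n) hr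
  have h2 := (le_abs_self _).trans (abs_ip_le_localNorm_mul hXp.inv
    (epochΔ_posSemidef (B := B) (β := β) (ρ := ρ) (e := e) hd hη n).1 hU)
  have h3 := (epoch_stability (e := e) h hρ).1
  have h4 := ip_mono_left (epochState_Pprev_sub_inv (B := B) (β := β) (ρ := ρ) (e := e)
    hd hη (Nat.lt_succ_self n)) hU
  rw [epochState_Pprev_succ] at h4
  set U := (epochState B η β ρ e n).U
  have h5 : ip (epochΔ B η β ρ e n) U ≤ 6 * η * ip (epochState B η β ρ e n).P U :=
    h2.trans (mul_le_mul h3 h4 (ip_nonneg hXp.inv.posSemidef hU) (by positivity))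
  rw [epochΔ, ip_sub_left, ip_comm _ U, ip_comm _ U] at h5
  have h6 : (2 * (1 + 6 * η) * β)⁻¹ = 84 / 5 * (d * Real.log T) / (1 + 6 * η) := by
    rw [h.β_eq, h.B_eq]
    field_simp
    norm_num
  have hη' := h.η_le
  have hdL : 0 < d * Real.log T := by positivity
  have h7 : 83 / 5 * (d * Real.log T) ≤ ip U (epochState B η β ρ e n).P := by
    refine le_trans ?_ h1
    rw [h6, le_div_iff₀ (by positivity)]
    nlinarith
  rw [le_div_iff₀ hd']
  nlinarith

/-- An epoch that ends by reset has nonpositive regret. -/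
lemma epoch_regret_nonpos (h : Tuning d T B η β)
    (hρ : ∀ i < n + 1, (ρ i).PosSemidef ∧ ρ i ≠ 0) (hn : n + 1 ≤ T)
    (hnr : 1 ≤ n → ¬ (epochState B η β ρ e n).ResetCondition η β)
    (hr : (epochState B η β ρ e (n + 1)).ResetCondition η β) {Y : Mat d}
    (hY : Y ∈ densityMatrices d) (hYT : (Y - (T : ℝ)⁻¹ • (1 : Mat d)).PosSemidef) :
    ∑ i ∈ Finset.range (n + 1), (logLoss (epochX B η β ρ e i) (ρ i) - logLoss Y (ρ i)) ≤ 0 := by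
  have hd' : (0 : ℝ) < d := by exact_mod_cast h.d_pos
  have hT : (0 : ℝ) < T := by linarith [h.le_T]
  have hB := h.B_pos
  have hL := h.four_le_log
  have hYp : Y ∈ pdDensityMatrices d := by
    refine ⟨?_, hY.2⟩
    have := (posDef_smul (PosDef.one (n := Fin d) (R := ℂ)) (inv_pos.2 hT)).add_posSemidef hYT
    rwa [add_sub_cancel] at this
  have h1 := epoch_regret_le h hρ hn (inTightRegion_succ h hρ hnr) hYp rfl
  have h2 := le_ip_of_reset h hρ hr
  set a := ip (epochState B η β ρ e (n + 1)).U (epochState B η β ρ e (n + 1)).Pprev / d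
  have h3 := logDetBarrier_le_of_smul_one_le (inv_pos.2 hT) hYT
  rw [Real.log_inv] at h3
  have ha : 0 < a := by linarith
  have h4 : Real.log a ≤ a / 8 + 2 := by
    have e1 := Real.log_le_sub_one_of_pos (by positivity : 0 < a / 8)
    rw [Real.log_div ha.ne' (by norm_num)] at e1
    have e2 : Real.log 8 = 3 * Real.log 2 := by
      rw [show (8 : ℝ) = 2 ^ 3 by norm_num, Real.log_pow]
      norm_num
    have := Real.log_two_lt_d9
    linarith
  have h5 : 4 * B * (logDetBarrier Y - d * Real.log d) ≤ d * B * (4 * Real.log T) := by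
    have := Real.log_nonneg h.one_le_d'
    have : logDetBarrier Y - d * Real.log d ≤ d * Real.log T := by nlinarith
    nlinarith
  have h6 : 4 * Real.log T + (43 / 22 * Real.log T + 18 / 11 * Real.log a + 1 - a) ≤ 0 := by
    linarith
  have h7 := mul_nonpos_of_nonneg_of_nonpos (by positivity : 0 ≤ d * B) h6
  linarith

/-- The regret of an epoch in which no reset has been triggered. -/
lemma epoch_regret_le_of_not_reset (h : Tuning d T B η β)
    (hρ : ∀ i < n, (ρ i).PosSemidef ∧ ρ i ≠ 0) (hn : n ≤ T)
    (hnr : 1 ≤ n → ¬ (epochState B η β ρ e n).ResetCondition η β) {Y : Mat d}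
    (hY : Y ∈ densityMatrices d) (hYR : ∀ i < n, 0 < ip Y (ρ i)) :
    ∑ i ∈ Finset.range n, (logLoss (epochX B η β ρ e i) (ρ i) - logLoss Y (ρ i))
      ≤ 400 * ((d : ℝ) ^ 3 * Real.log T ^ 2) := by
  have hd := h.d_pos
  have hd' : (0 : ℝ) < d := by exact_mod_cast h.d_pos
  have hT110 := h.le_T
  have hT : (0 : ℝ) < T := by linarith
  have hB := h.B_pos
  have hL := h.four_le_log
  -- mixing a `1 / T` fraction of the maximally mixed state makes the comparator positive definite
  set Z := mixedState d + (1 - (T : ℝ)⁻¹) • (Y - mixedState d) with hZ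
  have hTi : (0 : ℝ) < (T : ℝ)⁻¹ := inv_pos.2 hT
  have hTi2 : (T : ℝ)⁻¹ ≤ 1 / 2 := by
    rw [inv_le_comm₀ hT (by norm_num)]
    linarith
  have hZp : Z ∈ pdDensityMatrices d :=
    mix_mem_pdDensity (mixedState_mem hd) hY (by linarith) (by linarith)
  have hZe : Z = (1 - (T : ℝ)⁻¹) • Y + (T : ℝ)⁻¹ • mixedState d := by
    rw [hZ, smul_sub, sub_smul, sub_smul, one_smul, one_smul]
    abel
  have hZY : ∀ i < n, (1 - (T : ℝ)⁻¹) * ip Y (ρ i) ≤ ip Z (ρ i) := fun i hi => by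
    rw [hZe, ip_add_left, ip_smul_left, ip_smul_left]
    have := ip_nonneg (mixedState_mem hd).1.posSemidef (hρ i hi).1
    have := mul_nonneg hTi.le this
    linarith
  have hZbar : logDetBarrier Z ≤ d * (Real.log d + Real.log T) := by
    have h1 : (Z - ((d : ℝ) * T)⁻¹ • (1 : Mat d)).PosSemidef := by
      have e1 : (T : ℝ)⁻¹ • mixedState d = ((d : ℝ) * T)⁻¹ • (1 : Mat d) := by
        rw [mixedState, smul_smul, mul_inv, mul_comm]
      rw [hZe, e1, add_sub_cancel_right]
      exact posSemidef_smul hY.1 (by linarith)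
    have h2 := logDetBarrier_le_of_smul_one_le (by positivity) h1
    rw [Real.log_inv, Real.log_mul hd'.ne' hT.ne'] at h2
    linarith
  have h1 := epoch_regret_le h hρ hn (inTightRegion_of_not_reset h hρ hnr) hZp rfl
  have ha1 := one_le_ip_div (ρ := ρ) (e := e) h n
  set a := ip (epochState B η β ρ e n).U (epochState B η β ρ e n).Pprev / d
  have h2 : Real.log a ≤ a / 2 := by
    have := Real.log_le_sub_one_of_pos (by positivity : 0 < a / 2)
    rw [Real.log_div (by positivity) (by norm_num)] at this
    have := Real.log_two_lt_d9
    linarith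
  have h3 : d * B * (43 / 22 * Real.log T + 18 / 11 * Real.log a + 1 - a)
      ≤ d * B * (3 * Real.log T) :=
    mul_le_mul_of_nonneg_left (by linarith) (by positivity)
  have h4 : 4 * B * (logDetBarrier Z - d * Real.log d) ≤ d * B * (4 * Real.log T) := by
    have : logDetBarrier Z - d * Real.log d ≤ d * Real.log T := by linarith
    nlinarith
  -- each round loses at most `-log (1 - 1 / T) ≤ 2 / T` by the mixing
  have h5 : ∀ i ∈ Finset.range n, logLoss Z (ρ i) - logLoss Y (ρ i) ≤ 2 * (T : ℝ)⁻¹ := by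
    intro i hi
    have hi := Finset.mem_range.1 hi
    have hq : (0 : ℝ) < 1 - (T : ℝ)⁻¹ := by linarith
    have e1 := Real.log_le_log (mul_pos hq (hYR i hi)) (hZY i hi)
    rw [Real.log_mul hq.ne' (hYR i hi).ne'] at e1
    have e2 := Real.log_le_sub_one_of_pos (inv_pos.2 hq)
    rw [Real.log_inv] at e2
    have e3 : (1 - (T : ℝ)⁻¹)⁻¹ ≤ 1 + 2 * (T : ℝ)⁻¹ := by
      rw [inv_le_iff_one_le_mul₀ hq]
      nlinarith
    rw [logLoss, logLoss]
    linarith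
  have h6 : ∑ i ∈ Finset.range n, (logLoss Z (ρ i) - logLoss Y (ρ i)) ≤ 2 := by
    refine (Finset.sum_le_card_nsmul _ _ _ h5).trans ?_
    rw [Finset.card_range, nsmul_eq_mul]
    have : (n : ℝ) * (T : ℝ)⁻¹ ≤ 1 := by
      rw [← div_eq_mul_inv, div_le_one hT]
      exact_mod_cast hn
    linarith
  have h7 : ∑ i ∈ Finset.range n, (logLoss (epochX B η β ρ e i) (ρ i) - logLoss Y (ρ i))
      = ∑ i ∈ Finset.range n, (logLoss (epochX B η β ρ e i) (ρ i) - logLoss Z (ρ i))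
        + ∑ i ∈ Finset.range n, (logLoss Z (ρ i) - logLoss Y (ρ i)) := by
    rw [← Finset.sum_add_distrib]
    exact Finset.sum_congr rfl fun i _ => by ring
  have h8 : d * B * Real.log T = 264 / 5 * ((d : ℝ) ^ 3 * Real.log T ^ 2) := by
    rw [h.B_eq]; ring
  have h9 : 1 ≤ (d : ℝ) ^ 3 * Real.log T ^ 2 := by
    have e1 : (1 : ℝ) ≤ (d : ℝ) ^ 3 := one_le_pow₀ h.one_le_d'
    have e2 : 1 ≤ Real.log T ^ 2 := one_le_pow₀ (by linarith)
    nlinarith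
  rw [h7]
  linarith

/-! ### The decomposition of a run into epochs -/

lemma epochState_epoch (n : ℕ) : (epochState B η β ρ e n).epoch = e := by
  induction n with
  | zero => rfl
  | succ n ih => exact ih

/-- During the rounds `a, a + 1, …, a + m` the algorithm is in epoch `e` at the internal times
`0, …, m`, and no reset has been triggered at a positive one of them. -/
structure EpochRun (B η β : ℝ) (R : ℕ → Mat d) (e a m : ℕ) : Prop where
  run_eq : ∀ i ≤ m, run B η β R (a + i) = epochState B η β (fun j => R (a + j)) e i
  not_reset : ∀ i, 1 ≤ i → i ≤ m →
    ¬ (epochState B η β (fun j => R (a + j)) e i).ResetCondition η β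

/-- Epoch `e` ends by a reset that is triggered in round `a + m`, and it consists of the rounds
`a, …, a + m`. -/
def CompletedEpoch (B η β : ℝ) (R : ℕ → Mat d) (t e a m : ℕ) : Prop :=
  EpochRun B η β R e a m ∧ a + m + 1 ≤ t ∧
    (epochState B η β (fun j => R (a + j)) e (m + 1)).ResetCondition η β ∧
    ∀ s < t, (run B η β R s).epoch = e ↔ a ≤ s ∧ s ≤ a + m

/-- The first `t` rounds of a run consist of completed epochs and the current epoch, which is at
internal time `m`. -/
structure RunDecomposition (B η β : ℝ) (R : ℕ → Mat d) (t a m : ℕ) : Prop where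
  eq_t : a + m = t
  current : EpochRun B η β R (run B η β R t).epoch a m
  epoch_le : ∀ s ≤ t, (run B η β R s).epoch ≤ (run B η β R t).epoch
  mem_current : ∀ s < t, (run B η β R s).epoch = (run B η β R t).epoch ↔ a ≤ s
  completed : ∀ e, 1 ≤ e → e < (run B η β R t).epoch → ∃ a' m', CompletedEpoch B η β R t e a' m'

lemma run_succ (R : ℕ → Mat d) (t : ℕ) :
    run B η β R (t + 1) = (run B η β R t).step B η β (R t) := rfl

lemma exists_runDecomposition (B η β : ℝ) (R : ℕ → Mat d) (t : ℕ) :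
    ∃ a m, RunDecomposition B η β R t a m := by
  induction t with
  | zero =>
    refine ⟨0, 0, rfl, ⟨fun i hi => ?_, fun i h1 h2 => by omega⟩, fun s hs => ?_,
      fun s hs => by omega, fun e h1 h2 => ?_⟩
    · obtain rfl : i = 0 := by omega
      rfl
    · obtain rfl : s = 0 := by omega
      rfl
    · have : (run B η β R 0).epoch = 1 := rfl
      omega
  | succ t ih =>
    obtain ⟨a, m, rfl, hcur, hle, hmem, hcomp⟩ := ih
    set E := (run B η β R (a + m)).epoch with hE
    have hadv : (run B η β R (a + m)).advance B β (R (a + m))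
        = epochState B η β (fun j => R (a + j)) E (m + 1) := by
      rw [hcur.run_eq m le_rfl]
      rfl
    by_cases hr : (epochState B η β (fun j => R (a + j)) E (m + 1)).ResetCondition η β
    · have hrun : run B η β R (a + m + 1) = State.start d η (E + 1) := by
        rw [run_succ, State.step, hadv, if_pos hr]
      have hE1 : (run B η β R (a + m + 1)).epoch = E + 1 := by rw [hrun]; rfl
      refine ⟨a + m + 1, 0, rfl, ⟨fun i hi => ?_, fun i h1 h2 => by omega⟩, fun s hs => ?_,
        fun s hs => ?_, fun e h1 h2 => ?_⟩
      · obtain rfl : i = 0 := by omega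
        rw [hE1]
        exact hrun
      · rcases Nat.lt_or_ge s (a + m + 1) with h | h
        · have := hle s (by omega)
          omega
        · obtain rfl : s = a + m + 1 := by omega
          exact le_rfl
      · have := hle s (by omega)
        omega
      · rw [hE1] at h2
        rcases Nat.lt_succ_iff_lt_or_eq.1 h2 with h2 | rfl
        · obtain ⟨a', m', h3, h4, h5, h6⟩ := hcomp e h1 h2
          refine ⟨a', m', h3, by omega, h5, fun s hs => ?_⟩
          rcases Nat.lt_succ_iff_lt_or_eq.1 hs with hs | rfl
          · exact h6 s hs
          · omega
        · refine ⟨a, m, hcur, le_rfl, hr, fun s hs => ?_⟩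
          rcases Nat.lt_succ_iff_lt_or_eq.1 hs with hs | rfl
          · rw [hmem s hs]
            omega
          · simp [hE]
    · have hrun : run B η β R (a + m + 1)
          = epochState B η β (fun j => R (a + j)) E (m + 1) := by
        rw [run_succ, State.step, hadv, if_neg hr]
      have hE1 : (run B η β R (a + m + 1)).epoch = E := by rw [hrun, epochState_epoch]
      refine ⟨a, m + 1, rfl, ⟨fun i hi => ?_, fun i h1 h2 => ?_⟩, fun s hs => ?_,
        fun s hs => ?_, fun e h1 h2 => ?_⟩
      · rw [hE1]
        rcases Nat.lt_or_ge i (m + 1) with h | h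
        · exact hcur.run_eq i (by omega)
        · obtain rfl : i = m + 1 := by omega
          exact hrun
      · rw [hE1]
        rcases Nat.lt_or_ge i (m + 1) with h | h
        · exact hcur.not_reset i h1 (by omega)
        · obtain rfl : i = m + 1 := by omega
          exact hr
      · rw [hE1]
        rcases Nat.lt_or_ge s (a + m + 1) with h | h
        · exact hle s (by omega)
        · obtain rfl : s = a + m + 1 := by omega
          exact hE1.le
      · rw [hE1]
        rcases Nat.lt_or_ge s (a + m) with h | h
        · exact hmem s h
        · obtain rfl : s = a + m := by omega
          simp [hE]
      · rw [hE1] at h2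
        obtain ⟨a', m', h3, h4, h5, h6⟩ := hcomp e h1 h2
        refine ⟨a', m', h3, by omega, h5, fun s hs => ?_⟩
        rcases Nat.lt_or_ge s (a + m) with h | h
        · exact h6 s h
        · obtain rfl : s = a + m := by omega
          omega

lemma epochRegret_eq {R : ℕ → Mat d} {t a k : ℕ} (U : Mat d)
    (hrun : ∀ i < k, run B η β R (a + i) = epochState B η β (fun j => R (a + j)) e i)
    (hmem : epochRounds B η β R t e = Finset.Ico a (a + k)) :
    epochRegret B η β R t e U = ∑ i ∈ Finset.range k,
      (logLoss (epochX B η β (fun j => R (a + j)) e i) (R (a + i)) - logLoss U (R (a + i))) := by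
  rw [epochRegret, hmem, Finset.sum_Ico_eq_sum_range, Nat.add_sub_cancel_left]
  refine Finset.sum_congr rfl fun i hi => ?_
  rw [hrun i (Finset.mem_range.1 hi), epochX]

lemma CompletedEpoch.rounds_eq {R : ℕ → Mat d} {t a m : ℕ}
    (h : CompletedEpoch B η β R t e a m) :
    epochRounds B η β R t e = Finset.Ico a (a + (m + 1)) := by
  obtain ⟨-, h1, -, h2⟩ := h
  ext s
  rw [epochRounds, Finset.mem_filter, Finset.mem_range, Finset.mem_Ico]
  constructor
  · rintro ⟨h3, h4⟩
    have := (h2 s h3).1 h4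
    omega
  · rintro ⟨h3, h4⟩
    exact ⟨by omega, (h2 s (by omega)).2 ⟨h3, by omega⟩⟩

lemma RunDecomposition.rounds_eq {R : ℕ → Mat d} {t a m : ℕ}
    (h : RunDecomposition B η β R t a m) :
    epochRounds B η β R t (run B η β R t).epoch = Finset.Ico a (a + m) := by
  have h0 := h.eq_t
  ext s
  rw [epochRounds, Finset.mem_filter, Finset.mem_range, Finset.mem_Ico]
  constructor
  · rintro ⟨h3, h4⟩
    have := (h.mem_current s h3).1 h4
    omega
  · rintro ⟨h3, h4⟩
    exact ⟨by omega, (h.mem_current s (by omega)).2 h3⟩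

/-! ### Two-outcome measurements -/

lemma measurementLossMatrix_posSemidef {E : Mat d} {b : ℝ} (hE : E.PosSemidef)
    (hE' : (1 - E).PosSemidef) (h0 : 0 ≤ b) (h1 : b ≤ 1) :
    (measurementLossMatrix E b).PosSemidef :=
  (posSemidef_smul hE h0).add (posSemidef_smul hE' (by linarith))

lemma logLoss_measurementLossMatrix {X : Mat d} (hX : X ∈ densityMatrices d) (E : Mat d)
    (b : ℝ) : logLoss X (measurementLossMatrix E b) = binaryLogLoss (ip X E) b := by
  rw [logLoss, binaryLogLoss, measurementLossMatrix, ip_add_right, ip_smul_right, ip_smul_right,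
    ip_sub_right, ip_one_of_density hX]

end SchrodingerBISONS

theorem mainTheorem3 :
    (∃ C : ℝ, 0 < C ∧
      ∀ (d T : ℕ) (B η β : ℝ) (R : ℕ → Mat d),
        1 ≤ d → 110 * d ^ 2 ≤ T →
        B = 264 / 5 * (d : ℝ) ^ 2 * Real.log T →
        η = 1 / (4 * B) →
        β = 11 * (d : ℝ) / (7 * B) →
        (∀ t < T, (R t).PosSemidef ∧ R t ≠ 0) →
        -- every epoch that was ended by a reset within the `T` rounds
        (∀ e : ℕ, 1 ≤ e → e < (run B η β R T).epoch →
          ∀ U ∈ densityMatrices d, (U - (T : ℝ)⁻¹ • (1 : Mat d)).PosSemidef →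
            epochRegret B η β R T e U ≤ 0) ∧
        -- the epoch that is running when the game ends, against every comparator of finite loss
        (∀ U ∈ densityMatrices d,
          (∀ t ∈ epochRounds B η β R T (run B η β R T).epoch, 0 < ip U (R t)) →
            epochRegret B η β R T (run B η β R T).epoch U
              ≤ C * ((d : ℝ) ^ 3 * Real.log T ^ 2))) ∧
    -- online learning of quantum states with log loss is the case `R t = b E + (1 - b) (I - E)`
    (∀ (d : ℕ) (E : Mat d) (b : ℝ),
      E.PosSemidef → (1 - E).PosSemidef → 0 ≤ b → b ≤ 1 →
        (measurementLossMatrix E b).PosSemidef ∧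
        ∀ X ∈ densityMatrices d,
          logLoss X (measurementLossMatrix E b) = binaryLogLoss (ip X E) b) := by
  refine ⟨⟨400, by norm_num, ?_⟩, fun d E b hE hE' h0 h1 =>
    ⟨measurementLossMatrix_posSemidef hE hE' h0 h1, fun X hX =>
      logLoss_measurementLossMatrix hX E b⟩⟩
  intro d T B η β R hd hT hB hη hβ hR
  have h : Tuning d T B η β := ⟨hd, hT, hB, hη, hβ⟩
  obtain ⟨a, m, hdec⟩ := exists_runDecomposition B η β R T
  refine ⟨fun e he1 he2 U hU hUT => ?_, fun U hU hUR => ?_⟩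
  · obtain ⟨a', m', hc⟩ := hdec.completed e he1 he2
    have hrounds := hc.rounds_eq
    obtain ⟨hrun, hle, hreset, -⟩ := hc
    rw [epochRegret_eq U (fun i hi => hrun.run_eq i (by omega)) hrounds]
    exact epoch_regret_nonpos (ρ := fun j => R (a' + j)) h (fun i hi => hR _ (by omega))
      (by omega) (fun hm => hrun.not_reset m' hm le_rfl) hreset hU hUT
  · have hrounds := hdec.rounds_eq
    have heq := hdec.eq_t
    rw [hrounds] at hUR
    rw [epochRegret_eq U (fun i hi => hdec.current.run_eq i hi.le) hrounds]
    exact epoch_regret_le_of_not_reset (ρ := fun j => R (a + j)) h (fun i hi => hR _ (by omega))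
      (by omega) (fun hm => hdec.current.not_reset m hm le_rfl) hU
      (fun i hi => hUR _ (Finset.mem_Ico.2 ⟨by omega, by omega⟩))
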